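/- Let $n\ge 1$. For an $n\times n$ complex matrix $M$ with no zero entry let $M^{(-)}$ be its entrywise inverse, $(M^{(-)})_{ij}=1/M_{ij}$; let $\circ$ denote the entrywise product, and on $n\times n$ complex matrices put $X_A(M)=AM$ and $\Delta_B(M)=B\circ M$. The pair $(A,B)$ is a one-sided Jones pair if $X_A$ and $\Delta_B$ are invertible and $X_A\Delta_BX_A=\Delta_BX_A\Delta_B$; it is a Jones pair if both $(A,B)$ and $(A,B^T)$ are one-sided Jones pairs; a Jones pair is invertible if $A$ has no zero entry and $B$ is invertible. For a square complex matrix $M$ without zero entries, the Nomura algebra $\mathcal N_M$ is the set of all matrices of the same size for which every vector $Me_i\circ M^{(-)}e_j$ is an eigenvector. An association scheme on a nonempty finite set is a finite set $\mathcal A$ of nonzero $01$-matrices indexed by that set which contains $I$, sums to the all-ones matrix, is closed under transpose, and whose members commute with each other and have all pairwise products in the linear span of $\mathcal A$ (its Bose--Mesner algebra). For a nonempty index subset $Y$, $M_Y$ is the submatrix of $M$ on the rows and columns in $Y$; if the set of nonzero matrices among $\{M_Y: M\in\mathcal A\}$ is an association scheme, it is called the induced scheme of $\mathcal A$ on $Y$.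 **Theorem.** Let $(A,B)$ be an invertible Jones pair of $n\times n$ complex matrices with $A$ symmetric, let $d\in\mathbb C$ with $d^2=n$, and let $$W=\begin{pmatrix}A^T&-A^T\\ (B^{(-)})^T&(B^{(-)})^T\end{pmatrix},\qquad V=\begin{pmatrix} dA&-dA&B^{(-)}&B^{(-)}\\ -dA&dA&B^{(-)}&B^{(-)}\\ (B^{(-)})^T&(B^{(-)})^T&dA&-dA\\ (B^{(-)})^T&(B^{(-)})^T&-dA&dA\end{pmatrix}.$$ Put $Y=\{1,\dots,2n\}$ and $U=\{2n+1,\dots,4n\}$, and identify both with the index set of $W$ in the order-preserving way. Then $$\{M_Y: M\in\mathcal N_V\}=\mathcal N_{W^T}=\{M_U: M\in\mathcal N_V\}.$$ Moreover, $\mathcal N_V$ and $\mathcal N_{W^T}$ are the Bose--Mesner algebras of association schemes $\mathcal V$ and $\mathcal W$, and $\mathcal W$ is the induced scheme of $\mathcal V$ both on $Y$ and on $U$. -/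

import Mathlib

namespace JonesPair

open Matrix

variable {ι κ : Type*}

/-- The Schur (entrywise) inverse `A⁽⁻⁾`; it is only meaningful when all entries are nonzero. -/
noncomputable def schurInv (A : Matrix ι κ ℂ) : Matrix ι κ ℂ :=
  Matrix.of fun i j => (A i j)⁻¹

/-- `A` is Schur-invertible: every entry is nonzero. -/
def IsSchurInvertible (A : Matrix ι κ ℂ) : Prop :=
  ∀ i j, A i j ≠ 0

/-- The operator `X_A : M ↦ A M` on square matrices. -/
def opX [Fintype ι] (A : Matrix ι ι ℂ) : Module.End ℂ (Matrix ι ι ℂ) where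
  toFun M := A * M
  map_add' M N := Matrix.mul_add A M N
  map_smul' c M := Matrix.mul_smul A c M

/-- The operator `Δ_B : M ↦ B ∘ M` (Schur product) on square matrices. -/
def opDelta (B : Matrix ι ι ℂ) : Module.End ℂ (Matrix ι ι ℂ) where
  toFun M := B ⊙ M
  map_add' M N := Matrix.hadamard_add B M N
  map_smul' c M := Matrix.hadamard_smul B M c

/-- One-sided Jones pair: `X_A`, `Δ_B` are invertible and satisfy the braid relation. -/
structure IsOneSidedJonesPair [Fintype ι] (A B : Matrix ι ι ℂ) : Prop where
  isUnit_opX : IsUnit (opX A)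
  isUnit_opDelta : IsUnit (opDelta B)
  braid : opX A * opDelta B * opX A = opDelta B * opX A * opDelta B

/-- Jones pair: both `(A, B)` and `(A, Bᵀ)` are one-sided Jones pairs. -/
structure IsJonesPair [Fintype ι] (A B : Matrix ι ι ℂ) : Prop where
  left : IsOneSidedJonesPair A B
  right : IsOneSidedJonesPair A Bᵀ

/-- Invertible Jones pair: a Jones pair with `A` Schur-invertible and `B` invertible. -/
structure IsInvertibleJonesPair [Fintype ι] [DecidableEq ι] (A B : Matrix ι ι ℂ) : Prop where
  isJonesPair : IsJonesPair A B
  isSchurInvertible : IsSchurInvertible A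
  isUnit : IsUnit B

/-- The vector `A e_i ∘ A⁽⁻⁾ e_j`. -/
noncomputable def nomuraVec (A : Matrix ι ι ℂ) (i j : ι) : ι → ℂ :=
  fun k => A k i * schurInv A k j

/-- The Nomura algebra `N_A`: all matrices having every `A e_i ∘ A⁽⁻⁾ e_j` as an eigenvector. -/
noncomputable def nomura [Fintype ι] [DecidableEq ι] (A : Matrix ι ι ℂ) :
    Subalgebra ℂ (Matrix ι ι ℂ) where
  carrier := {M | ∀ i j, ∃ c : ℂ, M *ᵥ nomuraVec A i j = c • nomuraVec A i j}
  mul_mem' := by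
    intro M N hM hN i j
    obtain ⟨a, ha⟩ := hM i j
    obtain ⟨b, hb⟩ := hN i j
    refine ⟨b * a, ?_⟩
    rw [← Matrix.mulVec_mulVec, hb, Matrix.mulVec_smul, ha, smul_smul]
  add_mem' := by
    intro M N hM hN i j
    obtain ⟨a, ha⟩ := hM i j
    obtain ⟨b, hb⟩ := hN i j
    exact ⟨a + b, by rw [Matrix.add_mulVec, ha, hb, add_smul]⟩
  algebraMap_mem' := by
    intro c i j
    exact ⟨c, by rw [Algebra.algebraMap_eq_smul_one, Matrix.smul_mulVec, Matrix.one_mulVec]⟩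

/-- The `2n × 2n` matrix `W` of a pair `(A, B)` with `A` symmetric. -/
noncomputable def matW (A B : Matrix ι ι ℂ) : Matrix (ι ⊕ ι) (ι ⊕ ι) ℂ :=
  Matrix.fromBlocks Aᵀ (-Aᵀ) (schurInv B)ᵀ (schurInv B)ᵀ

/-- The `4n × 4n` matrix `V`. The four groups of rows and columns are, in order, `inl ∘ inl`,
`inl ∘ inr`, `inr ∘ inl` and `inr ∘ inr`; so `{1, …, 2n}` is the range of `inl` and
`{2n + 1, …, 4n}` the range of `inr`. -/
noncomputable def matV (d : ℂ) (A B : Matrix ι ι ℂ) :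
    Matrix ((ι ⊕ ι) ⊕ (ι ⊕ ι)) ((ι ⊕ ι) ⊕ (ι ⊕ ι)) ℂ :=
  Matrix.fromBlocks
    (Matrix.fromBlocks (d • A) (-(d • A)) (-(d • A)) (d • A))
    (Matrix.fromBlocks (schurInv B) (schurInv B) (schurInv B) (schurInv B))
    (Matrix.fromBlocks (schurInv B)ᵀ (schurInv B)ᵀ (schurInv B)ᵀ (schurInv B)ᵀ)
    (Matrix.fromBlocks (d • A) (-(d • A)) (-(d • A)) (d • A))

/-- A (commutative) association scheme, as the finite set of its (nonzero, hence distinct)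
adjacency matrices. -/
structure IsAssociationScheme [Fintype ι] [DecidableEq ι]
    (𝒜 : Finset (Matrix ι ι ℂ)) : Prop where
  zero_or_one : ∀ M ∈ 𝒜, ∀ i j, M i j = 0 ∨ M i j = 1
  ne_zero : ∀ M ∈ 𝒜, M ≠ 0
  one_mem : (1 : Matrix ι ι ℂ) ∈ 𝒜
  sum_eq : ∑ M ∈ 𝒜, M = Matrix.of fun _ _ => (1 : ℂ)
  transpose_mem : ∀ M ∈ 𝒜, Mᵀ ∈ 𝒜
  mul_mem_span : ∀ M ∈ 𝒜, ∀ N ∈ 𝒜, M * N ∈ Submodule.span ℂ (𝒜 : Set (Matrix ι ι ℂ))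
  mul_comm : ∀ M ∈ 𝒜, ∀ N ∈ 𝒜, M * N = N * M

/-- `𝒜` is an association scheme whose Bose–Mesner algebra (the span of `𝒜`) is `S`. -/
def IsSchemeOf [Fintype ι] [DecidableEq ι] (𝒜 : Finset (Matrix ι ι ℂ))
    (S : Subalgebra ℂ (Matrix ι ι ℂ)) : Prop :=
  IsAssociationScheme 𝒜 ∧
    Submodule.span ℂ (𝒜 : Set (Matrix ι ι ℂ)) = Subalgebra.toSubmodule S

/-- The matrix `M_Y`, where `Y` is the range of `f` and its elements are labelled through `f`. -/
def restrict (f : κ ↪ ι) (M : Matrix ι ι ℂ) : Matrix κ κ ℂ :=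
  M.submatrix f f

/-- The scheme `ℬ` is the induced scheme of `𝒜` on the nonempty set `Y`, the range of `f`:
it consists of the nonzero restrictions `M_Y` of the matrices of `𝒜`. -/
structure IsInducedScheme [Fintype ι] [DecidableEq ι] [Fintype κ] [DecidableEq κ]
    (𝒜 : Finset (Matrix ι ι ℂ)) (f : κ ↪ ι) (ℬ : Finset (Matrix κ κ ℂ)) : Prop where
  nonempty : Nonempty κ
  scheme : IsAssociationScheme 𝒜
  induced : IsAssociationScheme ℬ
  eq_restrict : (ℬ : Set (Matrix κ κ ℂ)) = (restrict f '' (𝒜 : Set (Matrix ι ι ℂ))) \ {0}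

end JonesPair

/-!
Up to scalars, the columns of `Wᵀ` and the halves of the columns of `V` are of the form `(v, v)` or
`(v, -v)`, and so are the Nomura vectors built from them. Hence an element of `N_{Wᵀ}` acts as some
`F` on the vectors `(v, v)` and as some `G` on the vectors `(v, -v)`, where `F` has the eigenvectors
`A e_i ∘ A⁽⁻⁾ e_j` and `G` the eigenvectors `A e_i ∘ B e_j`. Restricting an element of `N_V` to a
diagonal block gives such a matrix: `V` has its columns in pairs that differ only in the sign of
`A`, and averaging the eigenvector equations of such a pair separates the blocks.

The converse needs a second pair `(F', G')` whose eigenvalues are those of `(F, G)` with transposed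
arguments. It comes from the exchange lemma: since `A` has the eigenvectors `A e_i ∘ B e_j` with
eigenvalue matrix `B`, any other matrix with these eigenvectors is `A ∘ K` with eigenvalue matrix
`P B`, and `P` ranges over `N_{Aᵀ}`. This also gives `N_A = N_B`. Exchanging the two halves of the
index set turns `V` into the same matrix for `(A, Bᵀ)`, and `N_{Wᵀ}` does not change when `B` is
transposed, which settles `U`.

Both `V` and `Wᵀ` are type-II matrices, so their Nomura algebras are closed under transpose and the
Schur product. Their schemes consist of the indicators of the classes of positions at which all
matrices of the algebra agree, a description that is compatible with restriction to `Y` and `U`.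
-/

namespace JonesPair

open Matrix

section SchurIdempotents

variable {ι κ R : Type*}

section Classes

variable [Zero R] [One R] {S : Set (Matrix ι κ R)} {i k : ι} {j l : κ}

open Classical in
/-- The `01`-matrix marking the positions at which every matrix of `S` takes the value it takes at
position `(i, j)`. -/
noncomputable def schurClass (S : Set (Matrix ι κ R)) (i : ι) (j : κ) : Matrix ι κ R :=
  of fun k l => if ∀ M ∈ S, M k l = M i j then 1 else 0

open Classical in
/-- The Schur idempotents of the classes of positions not separated by `S`; they are the minimal
ones when `S` is a space of matrices closed under the Schur product. -/
noncomputable def schurIdempotents [Fintype ι] [Fintype κ] (S : Set (Matrix ι κ R)) :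
    Finset (Matrix ι κ R) :=
  Finset.univ.image fun p : ι × κ => schurClass S p.1 p.2

lemma schurClass_apply_self : schurClass S i j i j = 1 :=
  if_pos fun _ _ => rfl

lemma schurClass_eq_zero_or_one : schurClass S i j k l = 0 ∨ schurClass S i j k l = 1 := by
  classical exact (ite_eq_or_eq _ _ _).symm

lemma schurClass_transpose {S : Set (Matrix ι ι R)} (hS : ∀ M ∈ S, Mᵀ ∈ S) (i j : ι) :
    (schurClass S i j)ᵀ = schurClass S j i := by
  classical
  ext k l
  have h : (∀ M ∈ S, M l k = M i j) ↔ ∀ M ∈ S, M k l = M j i :=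
    ⟨fun h M hM => h Mᵀ (hS M hM), fun h M hM => h Mᵀ (hS M hM)⟩
  simp only [schurClass, transpose_apply, of_apply, h]

lemma mem_schurIdempotents [Fintype ι] [Fintype κ] {N : Matrix ι κ R} :
    N ∈ schurIdempotents S ↔ ∃ i j, schurClass S i j = N := by
  simp only [schurIdempotents, Finset.mem_image, Finset.mem_univ, true_and, Prod.exists]

lemma schurClass_mem_schurIdempotents [Fintype ι] [Fintype κ] (i : ι) (j : κ) :
    schurClass S i j ∈ schurIdempotents S :=
  mem_schurIdempotents.2 ⟨i, j, rfl⟩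

variable [NeZero (1 : R)]

lemma schurClass_apply_eq_one_iff : schurClass S i j k l = 1 ↔ ∀ M ∈ S, M k l = M i j := by
  classical exact ite_eq_left_iff.trans (by simp only [zero_ne_one, imp_false, not_not])

lemma schurClass_eq_iff : schurClass S i j = schurClass S k l ↔ ∀ M ∈ S, M i j = M k l := by
  classical
  refine ⟨fun h => schurClass_apply_eq_one_iff.1 (h ▸ schurClass_apply_self), fun h => ?_⟩
  ext a b
  have hiff : (∀ M ∈ S, M a b = M i j) ↔ ∀ M ∈ S, M a b = M k l :=
    forall₂_congr fun M hM => by rw [h M hM]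
  simp only [schurClass, of_apply, hiff]

lemma schurClass_ne_zero : schurClass S i j ≠ 0 := fun h =>
  one_ne_zero (schurClass_apply_self.symm.trans (congrFun₂ h i j))

open Classical in
lemma apply_eq_ite_of_mem_schurIdempotents [Fintype ι] [Fintype κ] {N : Matrix ι κ R}
    (hN : N ∈ schurIdempotents S) (i : ι) (j : κ) :
    N i j = if N = schurClass S i j then 1 else 0 := by
  obtain ⟨k, l, rfl⟩ := mem_schurIdempotents.1 hN
  simp only [eq_comm (a := schurClass S k l), schurClass_eq_iff]
  rfl

lemma schurClass_self_eq_one [DecidableEq ι] {S : Set (Matrix ι ι R)} (h1 : 1 ∈ S)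
    (hdiag : ∀ M ∈ S, ∀ i j, M i i = M j j) (i : ι) : schurClass S i i = 1 := by
  ext k l
  rcases eq_or_ne k l with rfl | hkl
  · rw [one_apply_eq, schurClass_apply_eq_one_iff]
    exact fun M hM => hdiag M hM k i
  · rw [one_apply_ne hkl]
    refine if_neg fun h => zero_ne_one (α := R) ?_
    rw [← one_apply_ne hkl, h 1 h1, one_apply_eq]

end Classes

section Restrict

variable {S : Set (Matrix ι ι ℂ)}

lemma restrict_schurClass (f : κ ↪ ι) (i j : κ) :
    restrict f (schurClass S (f i) (f j)) = schurClass (restrict f '' S) i j := by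
  classical
  ext k l
  simp only [schurClass, restrict, submatrix_apply, of_apply, Set.forall_mem_image]

lemma schurIdempotents_image_restrict [Fintype ι] [Fintype κ] (f : κ ↪ ι) :
    (schurIdempotents (restrict f '' S) : Set (Matrix κ κ ℂ)) =
      (restrict f '' (schurIdempotents S : Set (Matrix ι ι ℂ))) \ {0} := by
  classical
  refine Set.Subset.antisymm (fun N hN => ?_) ?_
  · obtain ⟨i, j, rfl⟩ := mem_schurIdempotents.1 hN
    exact ⟨⟨_, schurClass_mem_schurIdempotents (f i) (f j), restrict_schurClass f i j⟩,
      schurClass_ne_zero⟩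
  · rintro _ ⟨⟨M, hM, rfl⟩, h0⟩
    obtain ⟨i, j, hij⟩ : ∃ i j, restrict f M i j ≠ 0 := by
      by_contra! hzero
      exact h0 (Matrix.ext hzero)
    have hMij : M = schurClass S (f i) (f j) := by
      rw [restrict, submatrix_apply, apply_eq_ite_of_mem_schurIdempotents hM] at hij
      exact (ite_ne_right_iff.1 hij).1
    rw [hMij, restrict_schurClass]
    exact schurClass_mem_schurIdempotents i j

end Restrict

section Span

variable [Fintype ι] [Fintype κ]

lemma sum_smul_schurIdempotents_apply [Semiring R] [Nontrivial R] (S : Set (Matrix ι κ R))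
    (c : Matrix ι κ R → R) (i : ι) (j : κ) :
    (∑ N ∈ schurIdempotents S, c N • N) i j = c (schurClass S i j) := by
  classical
  rw [Matrix.sum_apply, Finset.sum_eq_single_of_mem _ (schurClass_mem_schurIdempotents i j),
    Matrix.smul_apply, schurClass_apply_self, smul_eq_mul, mul_one]
  intro N hN hne
  rw [Matrix.smul_apply, apply_eq_ite_of_mem_schurIdempotents hN, if_neg hne, smul_zero]

lemma mem_span_schurIdempotents [Semiring R] [Nontrivial R] {S : Set (Matrix ι κ R)}
    {M : Matrix ι κ R} (hM : M ∈ S) :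
    M ∈ Submodule.span R (schurIdempotents S : Set (Matrix ι κ R)) := by
  have hfactor : Function.FactorsThrough (fun p : ι × κ => M p.1 p.2)
      fun p => schurClass S p.1 p.2 := fun _ _ h => schurClass_eq_iff.1 h M hM
  obtain ⟨c, hc⟩ := (Function.factorsThrough_iff _).1 hfactor
  have hsum : M = ∑ N ∈ schurIdempotents S, c N • N := by
    ext i j
    rw [sum_smul_schurIdempotents_apply]
    exact congrFun hc (i, j)
  rw [hsum]
  exact Submodule.sum_mem _ fun N hN => Submodule.smul_mem _ _ (Submodule.subset_span hN)

end Span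

section Membership

lemma indicator_mem_subalgebra {α K : Type*} [Finite α] [Field K] (S : Subalgebra K (α → K))
    (x : α) : {y | ∀ f ∈ S, f y = f x}.indicator 1 ∈ S := by
  classical
  have := Fintype.ofFinite α
  have hsep : ∀ y, ∃ g ∈ S, g x = 1 ∧ ((¬ ∀ f ∈ S, f y = f x) → g y = 0) := by
    intro y
    by_cases hy : ∀ f ∈ S, f y = f x
    · exact ⟨1, S.one_mem, rfl, absurd hy⟩
    · push Not at hy
      obtain ⟨f, hf, hne⟩ := hy
      refine ⟨(f x - f y)⁻¹ • (f - algebraMap K _ (f y)),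
        S.smul_mem (S.sub_mem hf (S.algebraMap_mem _)) _, ?_, fun _ => ?_⟩
      · exact inv_mul_cancel₀ (sub_ne_zero.2 hne.symm)
      · exact mul_eq_zero_of_right _ (sub_self _)
  choose g hgS hgx hgy using hsep
  suffices h : {y | ∀ f ∈ S, f y = f x}.indicator 1 = ∏ y, g y from
    h ▸ S.prod_mem fun y _ => hgS y
  funext z
  rw [Finset.prod_apply]
  by_cases hz : z ∈ {y | ∀ f ∈ S, f y = f x}
  · rw [Set.indicator_of_mem hz, Finset.prod_eq_one fun y _ => (hz _ (hgS y)).trans (hgx y),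
      Pi.one_apply]
  · rw [Set.indicator_of_notMem hz,
      Finset.prod_eq_zero (f := fun y => g y z) (Finset.mem_univ z) (hgy z hz)]

lemma schurClass_mem_of_hadamard_mem [Finite ι] [Finite κ] {K : Type*} [Field K]
    {S : Submodule K (Matrix ι κ K)} (hJ : (of fun _ _ => (1 : K)) ∈ S)
    (hmul : ∀ M ∈ S, ∀ N ∈ S, M ⊙ N ∈ S) (i : ι) (j : κ) :
    schurClass (S : Set (Matrix ι κ K)) i j ∈ S := by
  let entries : Subalgebra K (ι × κ → K) :=
    (S.comap (LinearEquiv.curry K K ι κ ≪≫ₗ ofLinearEquiv K).toLinearMap).toSubalgebra hJ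
      fun f g hf hg => hmul _ hf _ hg
  have hclass (k : ι) (l : κ) : (∀ f ∈ entries, f (k, l) = f (i, j)) ↔
      ∀ M ∈ (S : Set (Matrix ι κ K)), M k l = M i j :=
    ⟨fun h M hM => h (Function.uncurry M) hM, fun h f hf => h _ hf⟩
  suffices h : schurClass (S : Set (Matrix ι κ K)) i j =
      of (Function.curry ({p | ∀ f ∈ entries, f p = f (i, j)}.indicator 1)) from
    h ▸ indicator_mem_subalgebra entries (i, j)
  classical
  ext k l
  simp only [schurClass, of_apply, ← hclass, Function.curry_apply, Set.indicator_apply,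
    Set.mem_ofPred_eq, Pi.one_apply]

end Membership

section Scheme

variable [Fintype ι] [DecidableEq ι]

lemma apply_eq_of_diagonal_mul_allOnes_comm [NonAssocSemiring R] {v : ι → R}
    (h : diagonal v * (of fun _ _ => 1) = (of fun _ _ => 1) * diagonal v) (i j : ι) :
    v i = v j := by
  simpa only [diagonal_mul, mul_diagonal, of_apply, mul_one, one_mul] using congrFun₂ h i j

variable {S : Subalgebra ℂ (Matrix ι ι ℂ)}

theorem isSchemeOf_schurIdempotents [Nonempty ι] (hJ : (of fun _ _ => (1 : ℂ)) ∈ S)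
    (hmul : ∀ M ∈ S, ∀ N ∈ S, M ⊙ N ∈ S) (htr : ∀ M ∈ S, Mᵀ ∈ S)
    (hcomm : ∀ M ∈ S, ∀ N ∈ S, M * N = N * M) :
    IsSchemeOf (schurIdempotents (S : Set (Matrix ι ι ℂ))) S := by
  set 𝒜 := schurIdempotents (S : Set (Matrix ι ι ℂ))
  have h𝒜 : ∀ N ∈ 𝒜, N ∈ S := fun N hN => by
    obtain ⟨i, j, rfl⟩ := mem_schurIdempotents.1 hN
    exact schurClass_mem_of_hadamard_mem (S := Subalgebra.toSubmodule S) hJ hmul i j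
  have hspan : Submodule.span ℂ (𝒜 : Set (Matrix ι ι ℂ)) = Subalgebra.toSubmodule S :=
    le_antisymm (Submodule.span_le.2 h𝒜) fun M hM => mem_span_schurIdempotents hM
  have hdiag : ∀ M ∈ (S : Set (Matrix ι ι ℂ)), ∀ i j, M i i = M j j := fun M hM =>
    apply_eq_of_diagonal_mul_allOnes_comm (v := M.diag)
      (hcomm _ (by simpa only [hadamard_one] using hmul M hM 1 S.one_mem) _ hJ)
  refine ⟨⟨?_, ?_, ?_, ?_, ?_, ?_, fun M hM N hN => hcomm M (h𝒜 M hM) N (h𝒜 N hN)⟩, hspan⟩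
  · intro N hN i j
    obtain ⟨k, l, rfl⟩ := mem_schurIdempotents.1 hN
    exact schurClass_eq_zero_or_one
  · intro N hN
    obtain ⟨i, j, rfl⟩ := mem_schurIdempotents.1 hN
    exact schurClass_ne_zero
  · obtain ⟨i⟩ := ‹Nonempty ι›
    exact mem_schurIdempotents.2 ⟨i, i, schurClass_self_eq_one S.one_mem hdiag i⟩
  · ext i j
    rw [of_apply, ← sum_smul_schurIdempotents_apply (S : Set _) (fun _ => (1 : ℂ)) i j]
    simp only [one_smul, 𝒜]
  · intro N hN
    obtain ⟨i, j, rfl⟩ := mem_schurIdempotents.1 hN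
    exact mem_schurIdempotents.2 ⟨j, i, (schurClass_transpose htr i j).symm⟩
  · intro M hM N hN
    rw [hspan]
    exact S.mul_mem (h𝒜 M hM) (h𝒜 N hN)

end Scheme

end SchurIdempotents

section EigenMatrix

variable {ι κ μ R : Type*} [Fintype ι] [CommRing R] {A : Matrix ι κ R} {B : Matrix ι μ R}
  {M N : Matrix ι ι R} {S T : Matrix κ μ R}

/-- `S` collects the eigenvalues of `M` on the vectors `A e_i ∘ B e_j`. When none of these vectors
vanishes, `S` is determined by `M`; the literature on Nomura algebras writes `S = Θ_{A,B}(M)`. -/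
def HasEigenMatrix (A : Matrix ι κ R) (B : Matrix ι μ R) (M : Matrix ι ι R) (S : Matrix κ μ R) :
    Prop :=
  ∀ i j, M *ᵥ (A.col i * B.col j) = S i j • (A.col i * B.col j)

lemma HasEigenMatrix.swap (h : HasEigenMatrix A B M S) : HasEigenMatrix B A M Sᵀ := fun j i => by
  rw [mul_comm, h i j, transpose_apply]

lemma hasEigenMatrix_swap_iff : HasEigenMatrix B A M Sᵀ ↔ HasEigenMatrix A B M S :=
  ⟨HasEigenMatrix.swap, HasEigenMatrix.swap⟩

lemma HasEigenMatrix.mul (hM : HasEigenMatrix A B M S) (hN : HasEigenMatrix A B N T) :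
    HasEigenMatrix A B (M * N) (S ⊙ T) := fun i j => by
  rw [← mulVec_mulVec, hN, mulVec_smul, hM, smul_smul, hadamard_apply, mul_comm]

lemma HasEigenMatrix.smul (h : HasEigenMatrix A B M S) (c : R) :
    HasEigenMatrix A B (c • M) (c • S) := fun i j => by
  rw [smul_mulVec, h, smul_smul, Matrix.smul_apply, smul_eq_mul]

lemma hasEigenMatrix_iff_apply : HasEigenMatrix A B M S ↔
    ∀ k i j, ∑ m, M k m * (A m i * B m j) = S i j * (A k i * B k j) :=
  ⟨fun h k i j => congrFun (h i j) k, fun h i j => funext fun k => h k i j⟩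

variable [DecidableEq ι]

lemma hasEigenMatrix_iff_forall_col [Fintype κ] [DecidableEq κ] : HasEigenMatrix A B M S ↔
    ∀ j, M * diagonal (B.col j) * A = diagonal (B.col j) * A * diagonal (S.col j) := by
  have hentry (k i j) : (M * diagonal (B.col j) * A) k i =
      (diagonal (B.col j) * A * diagonal (S.col j)) k i ↔
        ∑ m, M k m * (A m i * B m j) = S i j * (A k i * B k j) := by
    rw [mul_diagonal, diagonal_mul, mul_apply]
    simp only [mul_diagonal, col_apply, mul_comm, mul_left_comm]
  rw [hasEigenMatrix_iff_apply]
  exact ⟨fun h j => Matrix.ext fun k i => (hentry k i j).2 (h k i j),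
    fun h k i j => (hentry k i j).1 (congrFun₂ (h j) k i)⟩

lemma hasEigenMatrix_iff_forall_row [Fintype κ] [DecidableEq κ] [Fintype μ] [DecidableEq μ] :
    HasEigenMatrix A B M S ↔
      ∀ k, Bᵀ * diagonal (M.row k) * A = diagonal (B.row k) * Sᵀ * diagonal (A.row k) := by
  have hentry (k i j) : (Bᵀ * diagonal (M.row k) * A) j i =
      (diagonal (B.row k) * Sᵀ * diagonal (A.row k)) j i ↔
        ∑ m, M k m * (A m i * B m j) = S i j * (A k i * B k j) := by
    rw [mul_diagonal, diagonal_mul, mul_apply]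
    simp only [mul_diagonal, row_apply, transpose_apply, mul_comm, mul_left_comm]
  rw [hasEigenMatrix_iff_apply]
  exact ⟨fun h k => Matrix.ext fun j i => (hentry k i j).2 (h k i j),
    fun h k i j => (hentry k i j).1 (congrFun₂ (h k) j i)⟩

end EigenMatrix

section SchurInverse

variable {ι κ μ K : Type*} {A : Matrix ι κ ℂ}

lemma schurInv_schurInv (A : Matrix ι κ ℂ) : schurInv (schurInv A) = A :=
  Matrix.ext fun _ _ => inv_inv _

lemma IsSchurInvertible.transpose (hA : IsSchurInvertible A) : IsSchurInvertible Aᵀ :=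
  fun i j => hA j i

lemma IsSchurInvertible.schurInv (hA : IsSchurInvertible A) : IsSchurInvertible (schurInv A) :=
  fun i j => inv_ne_zero (hA i j)

lemma IsSchurInvertible.exists_eq_hadamard (hA : IsSchurInvertible A) (G : Matrix ι κ ℂ) :
    ∃ L, G = A ⊙ L :=
  ⟨of fun i j => G i j / A i j, Matrix.ext fun i j => by
    rw [hadamard_apply, of_apply, mul_div_cancel₀ _ (hA i j)]⟩

variable [Fintype ι] [DecidableEq ι]

lemma isUnit_diagonal_of_forall_ne_zero [Field K] {v : ι → K} (hv : ∀ i, v i ≠ 0) :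
    IsUnit (diagonal v) :=
  isUnit_diagonal.2 (Pi.isUnit_iff.2 fun i => (hv i).isUnit)

lemma diagonal_mul_diagonal_inv [Field K] {v : ι → K} (hv : ∀ i, v i ≠ 0) :
    diagonal v * diagonal v⁻¹ = 1 := by
  rw [diagonal_mul_diagonal, ← diagonal_one]
  exact congrArg diagonal (funext fun i => mul_inv_cancel₀ (hv i))

lemma diagonal_inv_mul_diagonal [Field K] {v : ι → K} (hv : ∀ i, v i ≠ 0) :
    diagonal v⁻¹ * diagonal v = 1 :=
  mul_eq_one_comm.1 (diagonal_mul_diagonal_inv hv)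

lemma HasEigenMatrix.schurInv {A : Matrix ι κ ℂ} {B : Matrix ι μ ℂ} {M N : Matrix ι ι ℂ}
    {S : Matrix κ μ ℂ} (h : HasEigenMatrix A B M S) (hNM : N * M = 1) (hS : IsSchurInvertible S) :
    HasEigenMatrix A B N (schurInv S) := fun i j => by
  have hinv : A.col i * B.col j = S i j • N *ᵥ (A.col i * B.col j) := by
    rw [← mulVec_smul, ← h, mulVec_mulVec, hNM, one_mulVec]
  exact (eq_inv_smul_iff₀ (hS i j)).2 hinv.symm

lemma HasEigenMatrix.left_injective [Nonempty μ] {A M N : Matrix ι ι ℂ} {B : Matrix ι μ ℂ}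
    {S : Matrix ι μ ℂ} (hA : IsUnit A) (hB : IsSchurInvertible B) (hM : HasEigenMatrix A B M S)
    (hN : HasEigenMatrix A B N S) : M = N := by
  obtain ⟨j⟩ := ‹Nonempty μ›
  have hMN := (hasEigenMatrix_iff_forall_col.1 hM j).trans
    (hasEigenMatrix_iff_forall_col.1 hN j).symm
  have hD : IsUnit (diagonal (B.col j)) := isUnit_diagonal_of_forall_ne_zero fun i => hB i j
  rwa [hA.mul_left_inj, hD.mul_left_inj] at hMN

lemma mem_nomura_iff_exists_hasEigenMatrix {M F : Matrix ι ι ℂ} :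
    F ∈ nomura M ↔ ∃ S, HasEigenMatrix M (schurInv M) F S :=
  ⟨fun h => Classical.skolem.1 fun i => Classical.skolem.1 (h i),
    fun ⟨S, hS⟩ i j => ⟨S i j, hS i j⟩⟩

end SchurInverse

section TypeII

variable {ι μ : Type*} [Fintype ι]

lemma transpose_mul_schurInv_apply (M : Matrix ι ι ℂ) (i j : ι) :
    (Mᵀ * schurInv M) i j = ∑ k, nomuraVec M i j k :=
  rfl

variable [DecidableEq ι]

/-- Type-II matrices: no entry vanishes and the Schur inverse is a multiple of the inverse
transpose. -/
structure IsTypeII (M : Matrix ι ι ℂ) : Prop where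
  isSchurInvertible : IsSchurInvertible M
  transpose_mul_schurInv : Mᵀ * schurInv M = (Fintype.card ι : ℂ) • (1 : Matrix ι ι ℂ)

variable {M F G : Matrix ι ι ℂ}

lemma isTypeII_of_sum_nomuraVec_eq_zero (hM : IsSchurInvertible M)
    (h : ∀ i j, i ≠ j → ∑ k, nomuraVec M i j k = 0) : IsTypeII M := by
  refine ⟨hM, Matrix.ext fun i j => ?_⟩
  rw [transpose_mul_schurInv_apply, Matrix.smul_apply]
  rcases eq_or_ne i j with rfl | hij
  · have hone (k) : nomuraVec M i i k = 1 := mul_inv_cancel₀ (hM k i)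
    simp [hone]
  · rw [h i j hij, one_apply_ne hij, smul_zero]

namespace IsTypeII

lemma sum_nomuraVec (hM : IsTypeII M) (i j : ι) :
    ∑ k, nomuraVec M i j k = if i = j then (Fintype.card ι : ℂ) else 0 := by
  rw [← transpose_mul_schurInv_apply, hM.transpose_mul_schurInv, Matrix.smul_apply, one_apply,
    smul_eq_mul, mul_ite, mul_one, mul_zero]

section Nonempty

variable [Nonempty ι]

lemma transpose_mul_inv_smul_schurInv (hM : IsTypeII M) :
    Mᵀ * ((Fintype.card ι : ℂ)⁻¹ • schurInv M) = 1 := by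
  rw [Matrix.mul_smul, hM.transpose_mul_schurInv,
    inv_smul_smul₀ (Nat.cast_ne_zero.2 Fintype.card_ne_zero)]

lemma schurInv_mul_transpose (hM : IsTypeII M) :
    schurInv M * Mᵀ = (Fintype.card ι : ℂ) • (1 : Matrix ι ι ℂ) := by
  rw [← mul_eq_one_comm.1 hM.transpose_mul_inv_smul_schurInv, Matrix.smul_mul,
    smul_inv_smul₀ (Nat.cast_ne_zero.2 Fintype.card_ne_zero)]

lemma isUnit (hM : IsTypeII M) : IsUnit M :=
  (isUnit_transpose M).1 (IsUnit.of_mul_eq_one _ hM.transpose_mul_inv_smul_schurInv)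

lemma transpose (hM : IsTypeII M) : IsTypeII Mᵀ :=
  ⟨hM.isSchurInvertible.transpose, by
    have h := congrArg Matrix.transpose hM.schurInv_mul_transpose
    rwa [transpose_mul, transpose_smul, transpose_one] at h⟩

/-- Nomura's duality `Θ_{Mᵀ}(Θ_M(F)) = n Fᵀ`. -/
lemma hasEigenMatrix_transpose (hM : IsTypeII M) {S : Matrix ι ι ℂ}
    (h : HasEigenMatrix M (schurInv M) F S) :
    HasEigenMatrix Mᵀ (schurInv Mᵀ) S ((Fintype.card ι : ℂ) • Fᵀ) := by
  refine hasEigenMatrix_iff_forall_col.2 fun k => ?_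
  have hrow := congrArg Matrix.transpose (hasEigenMatrix_iff_forall_row.1 h k)
  simp only [transpose_mul, transpose_transpose, diagonal_transpose, ← Matrix.mul_assoc] at hrow
  have hcancel : diagonal ((schurInv M).row k) * diagonal (M.row k) = 1 :=
    diagonal_inv_mul_diagonal (hM.isSchurInvertible k)
  calc S * diagonal ((schurInv M).row k) * Mᵀ
      = diagonal ((schurInv M).row k) *
          (diagonal (M.row k) * S * diagonal ((schurInv M).row k)) * Mᵀ := by
        rw [Matrix.mul_assoc (diagonal (M.row k)), ← Matrix.mul_assoc _ (diagonal (M.row k)),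
          hcancel, Matrix.one_mul]
    _ = diagonal ((schurInv M).row k) * (Mᵀ * diagonal (F.row k) * schurInv M) * Mᵀ := by
        rw [hrow]
    _ = diagonal ((schurInv M).row k) * Mᵀ * diagonal (F.row k) * (schurInv M * Mᵀ) := by
        simp only [Matrix.mul_assoc]
    _ = diagonal ((schurInv M).row k) * Mᵀ * diagonal (((Fintype.card ι : ℂ) • Fᵀ).col k) := by
        rw [hM.schurInv_mul_transpose, Matrix.mul_smul, Matrix.mul_one, ← Matrix.mul_smul,
          ← diagonal_smul]
        rfl

/-- The eigenvectors of `Fᵀ` form the basis dual to the eigenvectors of `F`; for a type-II matrix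
that is, up to a factor, the basis of Schur inverses. -/
lemma hasEigenMatrix_schurInv {A : Matrix ι ι ℂ} {B S : Matrix ι μ ℂ} (hA : IsTypeII A)
    (hB : IsSchurInvertible B) (h : HasEigenMatrix A B F S) :
    HasEigenMatrix (schurInv A) (schurInv B) Fᵀ S := by
  refine hasEigenMatrix_iff_forall_col.2 fun j => ?_
  set D := diagonal (B.col j)
  set D' := diagonal ((schurInv B).col j)
  set E := diagonal (S.col j)
  have hcol : Aᵀ * D * Fᵀ = E * Aᵀ * D := by
    have := congrArg Matrix.transpose (hasEigenMatrix_iff_forall_col.1 h j)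
    simpa only [transpose_mul, D, E, diagonal_transpose, ← Matrix.mul_assoc] using this
  have hDD' : D * D' = 1 := diagonal_mul_diagonal_inv fun i => hB i j
  have hDA : IsUnit (Aᵀ * D) := ((isUnit_transpose A).2 hA.isUnit).mul (IsUnit.of_mul_eq_one _ hDD')
  refine hDA.mul_right_injective ?_
  calc Aᵀ * D * (Fᵀ * D' * schurInv A)
      = E * Aᵀ * (D * D') * schurInv A := by simp only [← Matrix.mul_assoc, hcol]
    _ = E * (Aᵀ * schurInv A) := by rw [hDD', Matrix.mul_one, Matrix.mul_assoc]
    _ = (Aᵀ * schurInv A) * E := by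
        rw [hA.transpose_mul_schurInv, Matrix.mul_smul, Matrix.smul_mul, Matrix.one_mul,
          Matrix.mul_one]
    _ = Aᵀ * (D * D') * schurInv A * E := by rw [hDD', Matrix.mul_one]
    _ = Aᵀ * D * (D' * schurInv A * E) := by simp only [Matrix.mul_assoc]

lemma hasEigenMatrix_transpose_left (hM : IsTypeII M) {S : Matrix ι ι ℂ}
    (h : HasEigenMatrix M (schurInv M) F S) : HasEigenMatrix M (schurInv M) Fᵀ Sᵀ := by
  simpa only [schurInv_schurInv] using
    (hM.hasEigenMatrix_schurInv hM.isSchurInvertible.schurInv h).swap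

lemma mem_nomura_iff_exists_dual (hM : IsTypeII M) :
    F ∈ nomura M ↔ ∃ S, HasEigenMatrix Mᵀ (schurInv Mᵀ) S F := by
  refine mem_nomura_iff_exists_hasEigenMatrix.trans ⟨fun ⟨S, hS⟩ => ?_, fun ⟨S, hS⟩ => ?_⟩
  · have hdual := (hM.transpose.hasEigenMatrix_transpose_left
      (hM.hasEigenMatrix_transpose hS)).smul (Fintype.card ι : ℂ)⁻¹
    rw [transpose_smul, transpose_transpose,
      inv_smul_smul₀ (Nat.cast_ne_zero.2 Fintype.card_ne_zero)] at hdual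
    exact ⟨_, hdual⟩
  · exact ⟨_, hM.transpose.hasEigenMatrix_transpose hS⟩

lemma transpose_mem_nomura (hM : IsTypeII M) (hF : F ∈ nomura M) : Fᵀ ∈ nomura M := by
  obtain ⟨S, hS⟩ := mem_nomura_iff_exists_hasEigenMatrix.1 hF
  exact mem_nomura_iff_exists_hasEigenMatrix.2 ⟨Sᵀ, hM.hasEigenMatrix_transpose_left hS⟩

lemma hadamard_mem_nomura (hM : IsTypeII M) (hF : F ∈ nomura M) (hG : G ∈ nomura M) :
    F ⊙ G ∈ nomura M := by
  rw [hM.mem_nomura_iff_exists_dual] at *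
  obtain ⟨S, hS⟩ := hF
  obtain ⟨T, hT⟩ := hG
  exact ⟨S * T, hS.mul hT⟩

lemma allOnes_mem_nomura (hM : IsTypeII M) : (of fun _ _ => (1 : ℂ)) ∈ nomura M :=
  hM.mem_nomura_iff_exists_dual.2 ⟨1, fun _ _ => by rw [one_mulVec, of_apply, one_smul]⟩

lemma nomura_mul_comm (hM : IsTypeII M) (hF : F ∈ nomura M) (hG : G ∈ nomura M) :
    F * G = G * F := by
  obtain ⟨S, hS⟩ := mem_nomura_iff_exists_hasEigenMatrix.1 hF
  obtain ⟨T, hT⟩ := mem_nomura_iff_exists_hasEigenMatrix.1 hG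
  exact (hS.mul hT).left_injective hM.isUnit hM.isSchurInvertible.schurInv
    (hadamard_comm S T ▸ hT.mul hS)

theorem isSchemeOf_nomura (hM : IsTypeII M) :
    IsSchemeOf (schurIdempotents (nomura M : Set (Matrix ι ι ℂ))) (nomura M) :=
  isSchemeOf_schurIdempotents hM.allOnes_mem_nomura
    (fun _ hF _ hG => hM.hadamard_mem_nomura hF hG) (fun _ hF => hM.transpose_mem_nomura hF)
    fun _ hF _ hG => hM.nomura_mul_comm hF hG

end Nonempty

end IsTypeII

end TypeII

section DiagonalSums

variable {ι μ : Type*} [Fintype ι] [DecidableEq ι] {A B : Matrix ι ι ℂ}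

lemma HasEigenMatrix.transpose_mulVec_row_mul_col_inv {C S : Matrix ι μ ℂ} {M : Matrix ι ι ℂ}
    (hA : IsUnit A) (hC : IsSchurInvertible C) (h : HasEigenMatrix A C M S) (l : ι) :
    Sᵀ *ᵥ (A.row l * A⁻¹.col l) = fun _ => M l l := by
  funext j
  have hAA : A * A⁻¹ = 1 := mul_nonsing_inv _ ((isUnit_iff_isUnit_det _).1 hA)
  have hcol : M * diagonal (C.col j) = diagonal (C.col j) * (A * diagonal (S.col j) * A⁻¹) := by
    have := congrArg (· * A⁻¹) (hasEigenMatrix_iff_forall_col.1 h j)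
    simpa only [Matrix.mul_assoc, hAA, Matrix.mul_one] using this
  have hentry := congrFun₂ hcol l l
  rw [mul_diagonal, diagonal_mul, mul_comm] at hentry
  rw [mul_left_cancel₀ (hC l j) hentry, mul_apply]
  simp only [mulVec, dotProduct, mul_diagonal, transpose_apply, col_apply, row_apply, Pi.mul_apply]
  exact Finset.sum_congr rfl fun m _ => by ring

lemma isTypeII_of_card_mul_mul_inv_eq_one (hA : IsUnit A)
    (h : ∀ l m, (Fintype.card ι : ℂ) * (A l m * A⁻¹ m l) = 1) : IsTypeII A := by
  have hne (l m) : A l m ≠ 0 := fun h0 => by simpa [h0] using h l m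
  have hinv : schurInv A = (Fintype.card ι : ℂ) • (A⁻¹)ᵀ := Matrix.ext fun l m =>
    inv_eq_of_mul_eq_one_right ((mul_left_comm _ _ _).trans (h l m))
  exact ⟨hne, by rw [hinv, Matrix.mul_smul, ← transpose_mul,
    nonsing_inv_mul _ ((isUnit_iff_isUnit_det _).1 hA), transpose_one]⟩

/-- Each vector `(A l m * A⁻¹ m l)ₘ` is a multiple of `B⁻¹ 1`. Both the rows and the columns of the
array of these numbers sum to `1`, so all its entries are equal. -/
lemma isTypeII_of_mulVec_row_mul_col_inv (hA : IsUnit A) (hB : IsUnit B) {a : ι → ℂ}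
    (h : ∀ l, B *ᵥ (A.row l * A⁻¹.col l) = fun _ => a l) : IsTypeII A := by
  have hdet := (isUnit_iff_isUnit_det _).1 hA
  set w := B⁻¹ *ᵥ (fun _ => (1 : ℂ))
  have hv (l m) : A l m * A⁻¹ m l = a l * w m := by
    have hl : A.row l * A⁻¹.col l = a l • w := by
      rw [← mulVec_smul, Pi.smul_def, ← one_mulVec (A.row l * A⁻¹.col l),
        ← nonsing_inv_mul _ ((isUnit_iff_isUnit_det _).1 hB), ← mulVec_mulVec, h]
      simp only [smul_eq_mul, mul_one]
    exact congrFun hl m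
  have hcol (m) : (∑ l, a l) * w m = 1 := by
    have := congrFun₂ (nonsing_inv_mul A hdet) m m
    rw [mul_apply, one_apply_eq] at this
    simpa only [mul_comm (A⁻¹ _ _), hv, ← Finset.sum_mul] using this
  have hrow (l) : a l * ∑ m, w m = 1 := by
    have := congrFun₂ (mul_nonsing_inv A hdet) l l
    rw [mul_apply, one_apply_eq] at this
    simpa only [hv, ← Finset.mul_sum] using this
  have hsum (l) : Fintype.card ι * a l = ∑ l, a l := by
    calc Fintype.card ι * a l = a l * ∑ m, (∑ l, a l) * w m := by
          simp only [hcol, Finset.sum_const, Finset.card_univ, nsmul_eq_mul, mul_one, mul_comm]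
      _ = (∑ l, a l) * (a l * ∑ m, w m) := by rw [← Finset.mul_sum, mul_left_comm]
      _ = ∑ l, a l := by rw [hrow, mul_one]
  exact isTypeII_of_card_mul_mul_inv_eq_one hA fun l m => by
    rw [hv, ← mul_assoc, hsum, hcol]

end DiagonalSums

section Exchange

variable {ι μ : Type*} [Fintype ι] [DecidableEq ι] [Fintype μ]

/-- The exchange lemma of Chan, Godsil and Munemasa: one matrix with the eigenvectors
`A e_i ∘ B e_j` reduces the search for all of them to the Nomura algebra of `Bᵀ`. -/
lemma hasEigenMatrix_hadamard_mul_iff {A N K : Matrix ι ι ℂ} {B T : Matrix ι μ ℂ}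
    {P : Matrix μ μ ℂ} (hA : IsUnit A) (hB : IsSchurInvertible B) (hN : IsSchurInvertible N)
    (h : HasEigenMatrix A B N T) :
    HasEigenMatrix A B (N ⊙ K) (T * Pᵀ) ↔ HasEigenMatrix Bᵀ (schurInv Bᵀ) P Kᵀ := by
  classical
  rw [hasEigenMatrix_iff_forall_row, hasEigenMatrix_iff_forall_col]
  refine forall_congr' fun k => ?_
  set D := diagonal (B.row k)
  set D' := diagonal ((schurInv Bᵀ).col k)
  have hDD' : D * D' = 1 := diagonal_mul_diagonal_inv (hB k)
  have hNK : diagonal ((N ⊙ K).row k) = diagonal (K.row k) * diagonal (N.row k) := by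
    rw [diagonal_mul_diagonal]
    exact congrArg diagonal (mul_comm (N.row k) (K.row k))
  have hT : Tᵀ * diagonal (A.row k) = D' * Bᵀ * diagonal (N.row k) * A := by
    rw [Matrix.mul_assoc D', Matrix.mul_assoc D', hasEigenMatrix_iff_forall_row.1 h k,
      ← Matrix.mul_assoc, ← Matrix.mul_assoc, mul_eq_one_comm.1 hDD', Matrix.one_mul]
  have hleft : Bᵀ * diagonal ((N ⊙ K).row k) * A =
      D * (D' * Bᵀ * diagonal (K.row k)) * diagonal (N.row k) * A := by
    simp only [hNK, ← Matrix.mul_assoc, hDD', Matrix.one_mul]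
  have hright : D * (T * Pᵀ)ᵀ * diagonal (A.row k) =
      D * (P * D' * Bᵀ) * diagonal (N.row k) * A := by
    simp only [transpose_mul, transpose_transpose, Matrix.mul_assoc] at hT ⊢
    rw [hT]
  have := hA.invertible
  have hNk : IsUnit (diagonal (N.row k)) := isUnit_diagonal_of_forall_ne_zero (hN k)
  have := hNk.invertible
  have := (IsUnit.of_mul_eq_one _ hDD').invertible
  rw [hleft, hright, Matrix.mul_left_inj_of_invertible, Matrix.mul_left_inj_of_invertible,
    Matrix.mul_right_inj_of_invertible]
  exact eq_comm

end Exchange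

section JonesPairs

variable {ι : Type*} [Fintype ι] [DecidableEq ι] {A B F G K L P Q S : Matrix ι ι ℂ}

namespace IsOneSidedJonesPair

lemma isUnit (h : IsOneSidedJonesPair A B) : IsUnit A := by
  obtain ⟨M, hM⟩ := ((Module.End.isUnit_iff _).1 h.isUnit_opX).2 1
  exact IsUnit.of_mul_eq_one M hM

omit [DecidableEq ι] in
lemma isSchurInvertible (h : IsOneSidedJonesPair A B) : IsSchurInvertible B := by
  obtain ⟨M, hM⟩ := ((Module.End.isUnit_iff _).1 h.isUnit_opDelta).2 (of fun _ _ => 1)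
  have hBM (i j) : B i j * M i j = 1 := congrFun₂ hM i j
  exact fun i j h0 => by simpa [h0] using hBM i j

omit [DecidableEq ι] in
/-- The braid relation evaluated at the matrix units. -/
lemma hasEigenMatrix (h : IsOneSidedJonesPair A B) : HasEigenMatrix A B A B := by
  classical
  refine hasEigenMatrix_iff_apply.2 fun k l j => ?_
  have hbraid : (A * (B ⊙ (A * single l j 1))) k j = (B ⊙ (A * (B ⊙ single l j 1))) k j :=
    congrFun₂ (LinearMap.congr_fun h.braid (single l j 1)) k j
  have hsingle : B ⊙ single l j 1 = B l j • single l j (1 : ℂ) := by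
    ext m m'
    by_cases hm : l = m ∧ j = m'
    · simp [← hm.1, ← hm.2]
    · simp [single_apply_of_ne _ _ _ _ _ hm]
  rw [hsingle, Matrix.mul_smul, mul_apply, hadamard_apply, Matrix.smul_apply] at hbraid
  simp only [hadamard_apply, mul_single_apply_same, mul_one, smul_eq_mul] at hbraid
  calc ∑ m, A k m * (A m l * B m j) = ∑ m, A k m * (B m j * A m l) := by
        simp only [mul_comm (A _ l)]
    _ = B l j * (A k l * B k j) := by rw [hbraid]; ring

end IsOneSidedJonesPair

namespace IsInvertibleJonesPair

lemma transpose (h : IsInvertibleJonesPair A B) : IsInvertibleJonesPair A Bᵀ :=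
  ⟨⟨h.isJonesPair.right, h.isJonesPair.left⟩, h.isSchurInvertible, (isUnit_transpose B).2 h.isUnit⟩

lemma hasEigenMatrix (h : IsInvertibleJonesPair A B) : HasEigenMatrix A B A B :=
  h.isJonesPair.left.hasEigenMatrix

lemma isTypeII_left (h : IsInvertibleJonesPair A B) : IsTypeII A :=
  isTypeII_of_mulVec_row_mul_col_inv h.isJonesPair.left.isUnit h.isUnit fun l =>
    h.transpose.hasEigenMatrix.transpose_mulVec_row_mul_col_inv h.isJonesPair.left.isUnit
      h.isJonesPair.right.isSchurInvertible l

lemma isTypeII_right (h : IsInvertibleJonesPair A B) : IsTypeII B :=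
  isTypeII_of_mulVec_row_mul_col_inv h.isUnit h.isUnit fun l =>
    h.hasEigenMatrix.swap.transpose_mulVec_row_mul_col_inv h.isUnit h.isSchurInvertible l

lemma hasEigenMatrix_mul_transpose_iff (h : IsInvertibleJonesPair A B) :
    HasEigenMatrix A B (A ⊙ K) (B * Pᵀ) ↔ HasEigenMatrix Bᵀ (schurInv Bᵀ) P Kᵀ :=
  hasEigenMatrix_hadamard_mul_iff h.isJonesPair.left.isUnit h.isJonesPair.left.isSchurInvertible
    h.isSchurInvertible h.hasEigenMatrix

lemma hasEigenMatrix_mul_iff (h : IsInvertibleJonesPair A B) :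
    HasEigenMatrix A B (A ⊙ K) (P * B) ↔ HasEigenMatrix Aᵀ (schurInv Aᵀ) P Kᵀ := by
  rw [← hasEigenMatrix_swap_iff, transpose_mul]
  exact hasEigenMatrix_hadamard_mul_iff h.isUnit h.isSchurInvertible h.isSchurInvertible
    h.hasEigenMatrix.swap

lemma hasEigenMatrix_transpose_iff_of_mul_eq (h : IsInvertibleJonesPair A B)
    (hPQ : P * B = B * Qᵀ) :
    HasEigenMatrix Aᵀ (schurInv Aᵀ) P K ↔ HasEigenMatrix Bᵀ (schurInv Bᵀ) Q K := by
  rw [← transpose_transpose K, ← h.hasEigenMatrix_mul_iff, hPQ, h.hasEigenMatrix_mul_transpose_iff]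

lemma mul_inv_mul (h : IsInvertibleJonesPair A B) (M : Matrix ι ι ℂ) : B * (B⁻¹ * M) = M :=
  mul_nonsing_inv_cancel_left _ _ ((isUnit_iff_isUnit_det _).1 h.isUnit)

lemma mul_inv_mul_right (h : IsInvertibleJonesPair A B) (M : Matrix ι ι ℂ) : M * B⁻¹ * B = M :=
  nonsing_inv_mul_cancel_right _ _ ((isUnit_iff_isUnit_det _).1 h.isUnit)

lemma exists_mul_transpose_eq (h : IsInvertibleJonesPair A B) (P : Matrix ι ι ℂ) :
    ∃ Q : Matrix ι ι ℂ, P * B = B * Qᵀ :=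
  ⟨(B⁻¹ * (P * B))ᵀ, by rw [transpose_transpose, h.mul_inv_mul]⟩

lemma exists_hasEigenMatrix_transpose_right (h : IsInvertibleJonesPair A B)
    (hG : HasEigenMatrix A B G S) : ∃ T, HasEigenMatrix A Bᵀ G T := by
  obtain ⟨L, rfl⟩ := h.isSchurInvertible.exists_eq_hadamard G
  rw [← h.mul_inv_mul_right S, h.hasEigenMatrix_mul_iff] at hG
  exact ⟨_, h.transpose.hasEigenMatrix_mul_iff.2 hG⟩

variable [Nonempty ι]

lemma nomura_left_eq (h : IsInvertibleJonesPair A B) : nomura A = nomura B := by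
  refine SetLike.ext fun F => ?_
  rw [h.isTypeII_left.mem_nomura_iff_exists_dual, h.isTypeII_right.mem_nomura_iff_exists_dual]
  refine ⟨fun ⟨P, hP⟩ => ?_, fun ⟨Q, hQ⟩ => ?_⟩
  · obtain ⟨Q, hPQ⟩ := h.exists_mul_transpose_eq P
    exact ⟨Q, (h.hasEigenMatrix_transpose_iff_of_mul_eq hPQ).1 hP⟩
  · exact ⟨B * Qᵀ * B⁻¹,
      (h.hasEigenMatrix_transpose_iff_of_mul_eq (h.mul_inv_mul_right _)).2 hQ⟩

lemma mul_mul_transpose_comm (h : IsInvertibleJonesPair A B) (hQ : Q ∈ nomura Aᵀ) :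
    Q * (B * Bᵀ) = B * Bᵀ * Q := by
  set P := (Fintype.card ι : ℂ)⁻¹ • (schurInv B * B⁻¹)
  have hP : P ∈ nomura Aᵀ := by
    obtain ⟨L, hL⟩ := h.isSchurInvertible.exists_eq_hadamard A⁻¹
    have hinv : HasEigenMatrix A B (A ⊙ L) (schurInv B * B⁻¹ * B) := by
      rw [← hL, h.mul_inv_mul_right]
      exact h.hasEigenMatrix.schurInv
        (nonsing_inv_mul _ ((isUnit_iff_isUnit_det _).1 h.isTypeII_left.isUnit))
        h.isTypeII_right.isSchurInvertible
    exact Subalgebra.smul_mem _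
      (mem_nomura_iff_exists_hasEigenMatrix.2 ⟨_, h.hasEigenMatrix_mul_iff.1 hinv⟩) _
  have hPB : P * (B * Bᵀ) = 1 := by
    rw [Matrix.smul_mul, ← Matrix.mul_assoc, h.mul_inv_mul_right,
      h.isTypeII_right.schurInv_mul_transpose,
      inv_smul_smul₀ (Nat.cast_ne_zero.2 Fintype.card_ne_zero)]
  have hcomm := h.isTypeII_left.transpose.nomura_mul_comm hQ hP
  calc Q * (B * Bᵀ) = B * Bᵀ * P * (Q * (B * Bᵀ)) := by
        rw [mul_eq_one_comm.1 hPB, Matrix.one_mul]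
    _ = B * Bᵀ * (Q * P) * (B * Bᵀ) := by rw [hcomm]; simp only [Matrix.mul_assoc]
    _ = B * Bᵀ * Q := by rw [Matrix.mul_assoc, Matrix.mul_assoc Q, hPB, Matrix.mul_one]

/-- `F'` here and `G'` in `exists_extension_skew` make up the second diagonal block `twist F' G'` of
the element of `N_V` whose first diagonal block is a given element `twist F G` of `N_{Wᵀ}`. -/
lemma exists_extension_symm (h : IsInvertibleJonesPair A B) (hA : A.IsSymm)
    (hF : HasEigenMatrix A (schurInv A) F K) :
    ∃ F' K', HasEigenMatrix B (schurInv B) F K' ∧ HasEigenMatrix Bᵀ (schurInv Bᵀ) F' Kᵀ ∧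
      HasEigenMatrix A (schurInv A) F' K'ᵀ := by
  obtain ⟨K', hK'⟩ := mem_nomura_iff_exists_hasEigenMatrix.1
    (h.nomura_left_eq ▸ mem_nomura_iff_exists_hasEigenMatrix.2 ⟨K, hF⟩)
  obtain ⟨Q, hFQ⟩ := h.exists_mul_transpose_eq F
  have hQF : Q * Bᵀ = Bᵀ * Fᵀ := by
    rw [← transpose_mul, hFQ, transpose_mul, transpose_transpose]
  have hA_iff := h.hasEigenMatrix_transpose_iff_of_mul_eq (K := K) hFQ
  have hB_iff := h.transpose.hasEigenMatrix_transpose_iff_of_mul_eq (K := K') hQF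
  rw [hA.eq] at hA_iff hB_iff
  exact ⟨Qᵀ, K', hK', h.isTypeII_right.transpose.hasEigenMatrix_transpose_left (hA_iff.1 hF),
    h.isTypeII_left.hasEigenMatrix_transpose_left (hB_iff.2 hK')⟩

lemma hasEigenMatrix_schurInv_hadamard (h : IsInvertibleJonesPair A B) (hA : A.IsSymm)
    (hP : HasEigenMatrix A (schurInv A) P K) :
    HasEigenMatrix (schurInv A) (schurInv B) (A ⊙ K) (P * B) := by
  have hexchange : HasEigenMatrix A B (A ⊙ Kᵀ) (P * B) := by
    rwa [h.hasEigenMatrix_mul_iff, hA.eq, transpose_transpose]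
  simpa only [transpose_hadamard, hA.eq, transpose_transpose] using
    h.isTypeII_left.hasEigenMatrix_schurInv h.isTypeII_right.isSchurInvertible hexchange

lemma exists_extension_skew (h : IsInvertibleJonesPair A B) (hA : A.IsSymm)
    (hG : HasEigenMatrix A B G S) :
    ∃ G' S', HasEigenMatrix (schurInv A) (schurInv B) G S' ∧
      HasEigenMatrix (schurInv A) (schurInv Bᵀ) G' Sᵀ ∧ HasEigenMatrix A Bᵀ G' S'ᵀ := by
  obtain ⟨L, rfl⟩ := h.isSchurInvertible.exists_eq_hadamard G
  obtain ⟨Q, rfl⟩ : ∃ Q, S = Q * B := ⟨S * B⁻¹, (h.mul_inv_mul_right S).symm⟩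
  obtain ⟨R, hQR⟩ := h.exists_mul_transpose_eq Q
  have hQ := h.hasEigenMatrix_mul_iff.1 hG
  have hR := (h.hasEigenMatrix_transpose_iff_of_mul_eq hQR).1 hQ
  rw [hA.eq] at hQ
  have hQmem : Q ∈ nomura A := mem_nomura_iff_exists_hasEigenMatrix.2 ⟨_, hQ⟩
  obtain ⟨L', hL'⟩ := mem_nomura_iff_exists_hasEigenMatrix.1
    (h.transpose.nomura_left_eq.symm ▸ mem_nomura_iff_exists_hasEigenMatrix.2 ⟨_, hR⟩ :
      R ∈ nomura A)
  have hRB : R * Bᵀ = (Q * B)ᵀ := by rw [hQR, transpose_mul, transpose_transpose]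
  have hBQ : Rᵀ * Bᵀ = (Qᵀ * B)ᵀ := by
    refine h.isUnit.mul_right_injective ?_
    change B * (Rᵀ * Bᵀ) = B * (Qᵀ * B)ᵀ
    rw [← Matrix.mul_assoc, ← hQR, Matrix.mul_assoc, h.mul_mul_transpose_comm (hA.eq.symm ▸ hQmem),
      transpose_mul, transpose_transpose, Matrix.mul_assoc]
  refine ⟨A ⊙ L', Qᵀ * B, ?_, ?_, ?_⟩
  · simpa only [transpose_transpose] using h.hasEigenMatrix_schurInv_hadamard hA
      (h.isTypeII_left.hasEigenMatrix_transpose_left hQ)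
  · exact hRB ▸ h.transpose.hasEigenMatrix_schurInv_hadamard hA hL'
  · rw [← hBQ, h.transpose.hasEigenMatrix_mul_iff, hA.eq]
    exact h.isTypeII_left.hasEigenMatrix_transpose_left hL'

end IsInvertibleJonesPair

end JonesPairs

section Doubling

variable {ι : Type*} {v w : ι → ℂ}

/-- The vector `(v, v)`. -/
def symmVec (v : ι → ℂ) : ι ⊕ ι → ℂ :=
  Sum.elim v v

/-- The vector `(v, -v)`. -/
def skewVec (v : ι → ℂ) : ι ⊕ ι → ℂ :=
  Sum.elim v (-v)

/-- The matrix acting as `F` on the vectors `(v, v)` and as `G` on the vectors `(v, -v)`. -/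
noncomputable def twist (F G : Matrix ι ι ℂ) : Matrix (ι ⊕ ι) (ι ⊕ ι) ℂ :=
  (2⁻¹ : ℂ) • fromBlocks (F + G) (F - G) (F - G) (F + G)

lemma symmVec_mul_symmVec_inv (v w : ι → ℂ) : symmVec v * (symmVec w)⁻¹ = symmVec (v * w⁻¹) := by
  rw [symmVec, symmVec, ← Sum.elim_inv_inv, ← Sum.elim_mul_mul, symmVec]

lemma symmVec_mul_skewVec_inv (v w : ι → ℂ) : symmVec v * (skewVec w)⁻¹ = skewVec (v * w⁻¹) := by
  rw [symmVec, skewVec, ← Sum.elim_inv_inv, ← Sum.elim_mul_mul, inv_neg, mul_neg, skewVec]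

lemma skewVec_mul_symmVec_inv (v w : ι → ℂ) : skewVec v * (symmVec w)⁻¹ = skewVec (v * w⁻¹) := by
  rw [symmVec, skewVec, ← Sum.elim_inv_inv, ← Sum.elim_mul_mul, neg_mul, skewVec]

lemma skewVec_mul_skewVec_inv (v w : ι → ℂ) : skewVec v * (skewVec w)⁻¹ = symmVec (v * w⁻¹) := by
  rw [skewVec, skewVec, ← Sum.elim_inv_inv, ← Sum.elim_mul_mul, inv_neg, neg_mul_neg, symmVec]

lemma smul_vec_inv (s : ℂ) (v : ι → ℂ) : (s • v)⁻¹ = s⁻¹ • v⁻¹ :=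
  funext fun i => mul_inv s (v i)

lemma smul_sumElim {κ : Type*} (c : ℂ) (v : ι → ℂ) (w : κ → ℂ) :
    c • Sum.elim v w = Sum.elim (c • v) (c • w) :=
  funext fun x => by cases x <;> rfl

section Fintype

variable [Fintype ι] {P Q M F G : Matrix ι ι ℂ} {c : ℂ}

lemma sum_symmVec (v : ι → ℂ) : ∑ x, symmVec v x = 2 * ∑ i, v i :=
  (Fintype.sum_sum_type _).trans (two_mul _).symm

lemma sum_skewVec (v : ι → ℂ) : ∑ x, skewVec v x = 0 := by
  simp only [skewVec, Fintype.sum_sum_type, Sum.elim_inl, Sum.elim_inr, Pi.neg_apply,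
    Finset.sum_neg_distrib, add_neg_cancel]

lemma mulVec_smul_of_mulVec_eq (h : M *ᵥ v = c • v) (s : ℂ) : M *ᵥ (s • v) = c • (s • v) := by
  rw [mulVec_smul, h, smul_comm]

lemma twist_mulVec_symmVec (h : F *ᵥ v = c • v) : twist F G *ᵥ symmVec v = c • symmVec v := by
  rw [twist, symmVec, smul_mulVec, fromBlocks_mulVec, smul_sumElim, smul_sumElim, ← h]
  simp only [Sum.elim_comp_inl, Sum.elim_comp_inr, add_mulVec, sub_mulVec]
  congr 1 <;> module

lemma twist_mulVec_skewVec (h : G *ᵥ v = c • v) : twist F G *ᵥ skewVec v = c • skewVec v := by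
  rw [twist, skewVec, smul_mulVec, fromBlocks_mulVec, smul_sumElim, smul_sumElim, smul_neg, ← h]
  simp only [Sum.elim_comp_inl, Sum.elim_comp_inr, add_mulVec, sub_mulVec, mulVec_neg]
  congr 1 <;> module

lemma fromBlocks_zero_mulVec_sumElim (hv : P *ᵥ v = c • v) (hw : Q *ᵥ w = c • w) :
    fromBlocks P 0 0 Q *ᵥ Sum.elim v w = c • Sum.elim v w := by
  rw [fromBlocks_mulVec, smul_sumElim]
  simp only [Sum.elim_comp_inl, Sum.elim_comp_inr, zero_mulVec, add_zero, zero_add, hv, hw]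

lemma exists_restrict_inl_mulVec_eq {M : Matrix (ι ⊕ ι) (ι ⊕ ι) ℂ} {s c c' : ℂ} (hs : s ≠ 0)
    (h : M *ᵥ Sum.elim (s • v) w = c • Sum.elim (s • v) w)
    (h' : M *ᵥ Sum.elim (s • v) (-w) = c' • Sum.elim (s • v) (-w)) :
    ∃ b : ℂ, restrict Function.Embedding.inl M *ᵥ v = b • v := by
  rw [← fromBlocks_toBlocks M, fromBlocks_mulVec, smul_sumElim] at h h'
  have hl := congrArg (· ∘ Sum.inl) h
  have hl' := congrArg (· ∘ Sum.inl) h'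
  simp only [Sum.elim_comp_inl, Sum.elim_comp_inr, mulVec_neg, mulVec_smul] at hl hl'
  refine ⟨(c + c') / 2, smul_right_injective _ hs ?_⟩
  change s • (M.toBlocks₁₁ *ᵥ v) = s • ((c + c') / 2) • v
  linear_combination (norm := module) (2⁻¹ : ℂ) • (hl + hl')

lemma exists_eq_twist [DecidableEq ι] {κ μ : Type*} [Nonempty κ] [Nonempty μ]
    {A : Matrix ι ι ℂ} {B : Matrix ι μ ℂ} {C : Matrix ι κ ℂ} {K : Matrix ι κ ℂ} {S : Matrix ι μ ℂ}
    {P : Matrix (ι ⊕ ι) (ι ⊕ ι) ℂ} (hA : IsUnit A) (hB : IsSchurInvertible B)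
    (hC : IsSchurInvertible C)
    (hK : ∀ i j, P *ᵥ symmVec (A.col i * C.col j) = K i j • symmVec (A.col i * C.col j))
    (hS : ∀ i j, P *ᵥ skewVec (A.col i * B.col j) = S i j • skewVec (A.col i * B.col j)) :
    ∃ F G, HasEigenMatrix A C F K ∧ HasEigenMatrix A B G S ∧ P = twist F G := by
  obtain ⟨P₁₁, P₁₂, P₂₁, P₂₂, rfl⟩ : ∃ P₁₁ P₁₂ P₂₁ P₂₂, P = fromBlocks P₁₁ P₁₂ P₂₁ P₂₂ :=
    ⟨_, _, _, _, (fromBlocks_toBlocks P).symm⟩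
  simp only [symmVec, skewVec, fromBlocks_mulVec, smul_sumElim, Sum.elim_comp_inl,
    Sum.elim_comp_inr, Sum.elim_eq_iff, mulVec_neg, ← sub_eq_add_neg, ← add_mulVec, ← sub_mulVec]
    at hK hS
  have hF₁ : HasEigenMatrix A C (P₁₁ + P₁₂) K := fun i j => (hK i j).1
  have hF₂ : HasEigenMatrix A C (P₂₁ + P₂₂) K := fun i j => (hK i j).2
  have hG₁ : HasEigenMatrix A B (P₁₁ - P₁₂) S := fun i j => (hS i j).1
  have hG₂ : HasEigenMatrix A B (P₂₂ - P₂₁) S := fun i j => by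
    rw [← neg_sub, neg_mulVec, (hS i j).2, smul_neg, neg_neg]
  have hF := hF₁.left_injective hA hC hF₂
  have hG := hG₁.left_injective hA hB hG₂
  refine ⟨_, _, hF₁, hG₁, ?_⟩
  rw [twist, fromBlocks_smul]
  congr 1
  · module
  · module
  · rw [hF, hG]; module
  · rw [hF, hG]; module

end Fintype

end Doubling

section MatricesVW

variable {ι : Type*} {A B : Matrix ι ι ℂ} {d : ℂ}

/-- The sign with which `A` enters a column of `V`: `1` for the first and `-1` for the second of
the two groups of columns in each half. -/
def colSign : ι ⊕ ι → ℂ :=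
  Sum.elim 1 (-1)

/-- The position, within its group, of a column in one half of `V`. -/
def base : ι ⊕ ι → ι :=
  Sum.elim id id

lemma colSign_inv (x : ι ⊕ ι) : (colSign x)⁻¹ = colSign x := by
  cases x <;> simp [colSign]

lemma matV_col_inl (d : ℂ) (A B : Matrix ι ι ℂ) (x : ι ⊕ ι) :
    (matV d A B).col (.inl x) =
      Sum.elim ((colSign x * d) • skewVec (A.col (base x)))
        (symmVec ((schurInv Bᵀ).col (base x))) := by
  funext k
  rcases k with (k | k) | (k | k) <;> cases x <;>
    simp [matV, colSign, base, skewVec, symmVec, schurInv]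

lemma matV_col_inr (d : ℂ) (A B : Matrix ι ι ℂ) (x : ι ⊕ ι) :
    (matV d A B).col (.inr x) =
      Sum.elim (symmVec ((schurInv B).col (base x)))
        ((colSign x * d) • skewVec (A.col (base x))) := by
  funext k
  rcases k with (k | k) | (k | k) <;> cases x <;>
    simp [matV, colSign, base, skewVec, symmVec, schurInv]

lemma matW_transpose_col_inl (A B : Matrix ι ι ℂ) (i : ι) :
    (matW A B)ᵀ.col (.inl i) = skewVec (A.col i) := by
  funext k
  cases k <;> simp [matW, skewVec]

lemma matW_transpose_col_inr (A B : Matrix ι ι ℂ) (i : ι) :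
    (matW A B)ᵀ.col (.inr i) = symmVec ((schurInv B).col i) := by
  funext k
  cases k <;> simp [matW, symmVec]

lemma nomuraVec_eq_col_mul_inv (M : Matrix ι ι ℂ) (i j : ι) :
    nomuraVec M i j = M.col i * (M.col j)⁻¹ :=
  rfl

lemma schurInv_col (M : Matrix ι ι ℂ) (i : ι) : (schurInv M).col i = (M.col i)⁻¹ :=
  rfl

lemma nomuraVec_matV_inl_inl (hd : d ≠ 0) (x y : ι ⊕ ι) :
    nomuraVec (matV d A B) (.inl x) (.inl y) =
      Sum.elim ((colSign x * colSign y) • symmVec (nomuraVec A (base x) (base y)))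
        (symmVec (nomuraVec Bᵀ (base y) (base x))) := by
  rw [nomuraVec_eq_col_mul_inv, matV_col_inl, matV_col_inl, ← Sum.elim_inv_inv,
    ← Sum.elim_mul_mul, smul_vec_inv, smul_mul_smul_comm, skewVec_mul_skewVec_inv,
    symmVec_mul_symmVec_inv, schurInv_col, schurInv_col, inv_inv, mul_comm (Bᵀ.col _)⁻¹,
    mul_inv, mul_mul_mul_comm, mul_inv_cancel₀ hd, mul_one, colSign_inv]
  rfl

lemma nomuraVec_matV_inr_inr (hd : d ≠ 0) (x y : ι ⊕ ι) :
    nomuraVec (matV d A B) (.inr x) (.inr y) =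
      Sum.elim (symmVec (nomuraVec B (base y) (base x)))
        ((colSign x * colSign y) • symmVec (nomuraVec A (base x) (base y))) := by
  rw [nomuraVec_eq_col_mul_inv, matV_col_inr, matV_col_inr, ← Sum.elim_inv_inv,
    ← Sum.elim_mul_mul, smul_vec_inv, smul_mul_smul_comm, skewVec_mul_skewVec_inv,
    symmVec_mul_symmVec_inv, schurInv_col, schurInv_col, inv_inv, mul_comm (B.col _)⁻¹,
    mul_inv, mul_mul_mul_comm, mul_inv_cancel₀ hd, mul_one, colSign_inv]
  rfl

lemma nomuraVec_matV_inl_inr (d : ℂ) (A B : Matrix ι ι ℂ) (x y : ι ⊕ ι) :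
    nomuraVec (matV d A B) (.inl x) (.inr y) =
      Sum.elim ((colSign x * d) • skewVec (A.col (base x) * B.col (base y)))
        ((colSign y * d⁻¹) •
          skewVec ((schurInv A).col (base y) * (schurInv Bᵀ).col (base x))) := by
  rw [nomuraVec_eq_col_mul_inv, matV_col_inl, matV_col_inr, ← Sum.elim_inv_inv,
    ← Sum.elim_mul_mul, smul_vec_inv, smul_mul_assoc, mul_smul_comm, skewVec_mul_symmVec_inv,
    symmVec_mul_skewVec_inv, mul_inv, colSign_inv, mul_comm ((schurInv Bᵀ).col _),
    schurInv_col B, inv_inv, schurInv_col A]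

lemma nomuraVec_matV_inr_inl (d : ℂ) (A B : Matrix ι ι ℂ) (x y : ι ⊕ ι) :
    nomuraVec (matV d A B) (.inr x) (.inl y) =
      Sum.elim
        ((colSign y * d⁻¹) • skewVec ((schurInv A).col (base y) * (schurInv B).col (base x)))
        ((colSign x * d) • skewVec (A.col (base x) * Bᵀ.col (base y))) := by
  rw [nomuraVec_eq_col_mul_inv, matV_col_inl, matV_col_inr, ← Sum.elim_inv_inv,
    ← Sum.elim_mul_mul, smul_vec_inv, smul_mul_assoc, mul_smul_comm, skewVec_mul_symmVec_inv,
    symmVec_mul_skewVec_inv, mul_inv, colSign_inv, mul_comm ((schurInv B).col _),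
    schurInv_col Bᵀ, inv_inv, schurInv_col A]

lemma nomuraVec_matW_inl_inl (A B : Matrix ι ι ℂ) (i j : ι) :
    nomuraVec (matW A B)ᵀ (.inl i) (.inl j) = symmVec (nomuraVec A i j) := by
  rw [nomuraVec_eq_col_mul_inv, matW_transpose_col_inl, matW_transpose_col_inl,
    skewVec_mul_skewVec_inv, nomuraVec_eq_col_mul_inv]

lemma nomuraVec_matW_inr_inr (A B : Matrix ι ι ℂ) (i j : ι) :
    nomuraVec (matW A B)ᵀ (.inr i) (.inr j) = symmVec (nomuraVec B j i) := by
  rw [nomuraVec_eq_col_mul_inv, matW_transpose_col_inr, matW_transpose_col_inr,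
    symmVec_mul_symmVec_inv, nomuraVec_eq_col_mul_inv, schurInv_col, schurInv_col, inv_inv,
    mul_comm]

lemma nomuraVec_matW_inl_inr (A B : Matrix ι ι ℂ) (i j : ι) :
    nomuraVec (matW A B)ᵀ (.inl i) (.inr j) = skewVec (A.col i * B.col j) := by
  rw [nomuraVec_eq_col_mul_inv, matW_transpose_col_inl, matW_transpose_col_inr,
    skewVec_mul_symmVec_inv, schurInv_col, inv_inv]

lemma nomuraVec_matW_inr_inl (A B : Matrix ι ι ℂ) (i j : ι) :
    nomuraVec (matW A B)ᵀ (.inr i) (.inl j) =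
      skewVec ((schurInv A).col j * (schurInv B).col i) := by
  rw [nomuraVec_eq_col_mul_inv, matW_transpose_col_inl, matW_transpose_col_inr,
    symmVec_mul_skewVec_inv, mul_comm, schurInv_col A]

end MatricesVW

section TypeIIVW

variable {ι κ : Type*} {A B : Matrix ι ι ℂ} {d : ℂ}

lemma IsSchurInvertible.neg {M : Matrix ι κ ℂ} (hM : IsSchurInvertible M) :
    IsSchurInvertible (-M) :=
  fun i j => neg_ne_zero.2 (hM i j)

lemma IsSchurInvertible.smul {M : Matrix ι κ ℂ} (hM : IsSchurInvertible M) (hd : d ≠ 0) :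
    IsSchurInvertible (d • M) :=
  fun i j => mul_ne_zero hd (hM i j)

lemma IsSchurInvertible.fromBlocks {ι' κ' : Type*} {M₁₁ : Matrix ι κ ℂ} {M₁₂ : Matrix ι κ' ℂ}
    {M₂₁ : Matrix ι' κ ℂ} {M₂₂ : Matrix ι' κ' ℂ} (h₁₁ : IsSchurInvertible M₁₁)
    (h₁₂ : IsSchurInvertible M₁₂) (h₂₁ : IsSchurInvertible M₂₁) (h₂₂ : IsSchurInvertible M₂₂) :
    IsSchurInvertible (fromBlocks M₁₁ M₁₂ M₂₁ M₂₂)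
  | .inl i, .inl j => h₁₁ i j
  | .inl i, .inr j => h₁₂ i j
  | .inr i, .inl j => h₂₁ i j
  | .inr i, .inr j => h₂₂ i j

lemma IsSchurInvertible.matW (hA : IsSchurInvertible A) (hB : IsSchurInvertible B) :
    IsSchurInvertible (matW A B) :=
  hA.transpose.fromBlocks hA.transpose.neg hB.schurInv.transpose hB.schurInv.transpose

lemma IsSchurInvertible.matV (hd : d ≠ 0) (hA : IsSchurInvertible A) (hB : IsSchurInvertible B) :
    IsSchurInvertible (matV d A B) :=
  have hdA := hA.smul hd
  have hdAA := hdA.fromBlocks hdA.neg hdA.neg hdA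
  have hB' := hB.schurInv
  have hBt := hB'.transpose
  hdAA.fromBlocks (hB'.fromBlocks hB' hB' hB') (hBt.fromBlocks hBt hBt hBt) hdAA

lemma colSign_mul_colSign_of_ne {x y : ι ⊕ ι} (hxy : x ≠ y) (hbase : base x = base y) :
    colSign x * colSign y = -1 := by
  rcases x with x | x <;> rcases y with y | y <;> simp_all [base, colSign]

variable [Fintype ι] [DecidableEq ι]

lemma IsTypeII.matW_transpose (hA : IsTypeII A) (hB : IsTypeII B) : IsTypeII (matW A B)ᵀ := by
  refine isTypeII_of_sum_nomuraVec_eq_zero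
    (hA.isSchurInvertible.matW hB.isSchurInvertible).transpose ?_
  rintro (i | i) (j | j) hij
  · rw [nomuraVec_matW_inl_inl, sum_symmVec, hA.sum_nomuraVec, if_neg (ne_of_apply_ne _ hij),
      mul_zero]
  · rw [nomuraVec_matW_inl_inr, sum_skewVec]
  · rw [nomuraVec_matW_inr_inl, sum_skewVec]
  · rw [nomuraVec_matW_inr_inr, sum_symmVec, hB.sum_nomuraVec, if_neg (ne_of_apply_ne _ hij.symm),
      mul_zero]

lemma IsTypeII.colSign_mul_sum_add_sum_eq_zero (hA : IsTypeII A) (hB : IsTypeII B) {x y : ι ⊕ ι}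
    (hxy : x ≠ y) :
    colSign x * colSign y * ∑ k, nomuraVec A (base x) (base y) k +
      ∑ k, nomuraVec B (base y) (base x) k = 0 := by
  rw [hA.sum_nomuraVec, hB.sum_nomuraVec]
  by_cases hbase : base x = base y
  · rw [if_pos hbase, if_pos hbase.symm, colSign_mul_colSign_of_ne hxy hbase, neg_one_mul,
      neg_add_cancel]
  · rw [if_neg hbase, if_neg (Ne.symm hbase), mul_zero, add_zero]

lemma IsTypeII.matV (hd : d ≠ 0) (hA : IsTypeII A) (hB : IsTypeII B) : IsTypeII (matV d A B) := by
  refine isTypeII_of_sum_nomuraVec_eq_zero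
    (hA.isSchurInvertible.matV hd hB.isSchurInvertible) ?_
  rintro (x | x) (y | y) hxy <;> rw [Fintype.sum_sum_type]
  · have : Nonempty ι := ⟨base x⟩
    simp only [nomuraVec_matV_inl_inl hd, Sum.elim_inl, Sum.elim_inr, Pi.smul_apply, smul_eq_mul,
      ← Finset.mul_sum, sum_symmVec]
    linear_combination
      2 * hA.colSign_mul_sum_add_sum_eq_zero hB.transpose (ne_of_apply_ne Sum.inl hxy)
  · simp only [nomuraVec_matV_inl_inr, Sum.elim_inl, Sum.elim_inr, Pi.smul_apply, ← Finset.smul_sum,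
      sum_skewVec, smul_zero, add_zero]
  · simp only [nomuraVec_matV_inr_inl, Sum.elim_inl, Sum.elim_inr, Pi.smul_apply, ← Finset.smul_sum,
      sum_skewVec, smul_zero, add_zero]
  · simp only [nomuraVec_matV_inr_inr hd, Sum.elim_inl, Sum.elim_inr, Pi.smul_apply, smul_eq_mul,
      ← Finset.mul_sum, sum_symmVec]
    linear_combination
      2 * hA.colSign_mul_sum_add_sum_eq_zero hB (ne_of_apply_ne Sum.inr hxy)

end TypeIIVW

section NomuraVW

variable {ι : Type*} [Fintype ι] [DecidableEq ι] {A B F F' G G' K K' S S' : Matrix ι ι ℂ} {d : ℂ}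

lemma twist_mem_nomura_matW (hFA : HasEigenMatrix A (schurInv A) F K)
    (hFB : HasEigenMatrix B (schurInv B) F K') (hG : HasEigenMatrix A B G S)
    (hG' : HasEigenMatrix (schurInv A) (schurInv B) G S') :
    twist F G ∈ nomura (matW A B)ᵀ := by
  rintro (i | i) (j | j)
  · exact ⟨_, nomuraVec_matW_inl_inl A B i j ▸ twist_mulVec_symmVec (hFA i j)⟩
  · exact ⟨_, nomuraVec_matW_inl_inr A B i j ▸ twist_mulVec_skewVec (hG i j)⟩
  · exact ⟨_, nomuraVec_matW_inr_inl A B i j ▸ twist_mulVec_skewVec (hG' j i)⟩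
  · exact ⟨_, nomuraVec_matW_inr_inr A B i j ▸ twist_mulVec_symmVec (hFB j i)⟩

lemma fromBlocks_twist_mem_nomura_matV (hd : d ≠ 0) (hFA : HasEigenMatrix A (schurInv A) F K)
    (hFB : HasEigenMatrix B (schurInv B) F K') (hF'B : HasEigenMatrix Bᵀ (schurInv Bᵀ) F' Kᵀ)
    (hF'A : HasEigenMatrix A (schurInv A) F' K'ᵀ) (hG : HasEigenMatrix A B G S)
    (hGinv : HasEigenMatrix (schurInv A) (schurInv B) G S')
    (hG'inv : HasEigenMatrix (schurInv A) (schurInv Bᵀ) G' Sᵀ) (hG' : HasEigenMatrix A Bᵀ G' S'ᵀ) :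
    fromBlocks (twist F G) 0 0 (twist F' G') ∈ nomura (matV d A B) := by
  rintro (x | x) (y | y)
  · refine ⟨K (base x) (base y), nomuraVec_matV_inl_inl hd x y ▸ ?_⟩
    exact fromBlocks_zero_mulVec_sumElim
      (mulVec_smul_of_mulVec_eq (twist_mulVec_symmVec (hFA _ _)) _)
      (twist_mulVec_symmVec (hF'B _ _))
  · refine ⟨S (base x) (base y), nomuraVec_matV_inl_inr d A B x y ▸ ?_⟩
    exact fromBlocks_zero_mulVec_sumElim
      (mulVec_smul_of_mulVec_eq (twist_mulVec_skewVec (hG _ _)) _)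
      (mulVec_smul_of_mulVec_eq (twist_mulVec_skewVec (hG'inv _ _)) _)
  · refine ⟨S' (base y) (base x), nomuraVec_matV_inr_inl d A B x y ▸ ?_⟩
    exact fromBlocks_zero_mulVec_sumElim
      (mulVec_smul_of_mulVec_eq (twist_mulVec_skewVec (hGinv _ _)) _)
      (mulVec_smul_of_mulVec_eq (twist_mulVec_skewVec (hG' _ _)) _)
  · refine ⟨K' (base y) (base x), nomuraVec_matV_inr_inr hd x y ▸ ?_⟩
    exact fromBlocks_zero_mulVec_sumElim
      (twist_mulVec_symmVec (hFB _ _))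
      (mulVec_smul_of_mulVec_eq (twist_mulVec_symmVec (hF'A _ _)) _)

/-- Replacing one column of `V` by its companion of opposite sign negates one half of a Nomura
vector and fixes the other, so averaging the two eigenvector equations isolates a diagonal block. -/
lemma restrict_inl_mem_nomura_matW (hd : d ≠ 0)
    {M : Matrix ((ι ⊕ ι) ⊕ (ι ⊕ ι)) ((ι ⊕ ι) ⊕ (ι ⊕ ι)) ℂ} (hM : M ∈ nomura (matV d A B)) :
    restrict Function.Embedding.inl M ∈ nomura (matW A B)ᵀ := by
  choose c hc using (hM : ∀ i j, ∃ c : ℂ, M *ᵥ nomuraVec (matV d A B) i j =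
    c • nomuraVec (matV d A B) i j)
  rintro (i | i) (j | j)
  · have h := hc (.inl (.inl i)) (.inl (.inl j))
    have h' := mulVec_smul_of_mulVec_eq (hc (.inl (.inl i)) (.inl (.inr j))) (-1)
    rw [nomuraVec_matV_inl_inl hd] at h h'
    rw [smul_sumElim] at h'
    simp only [colSign, base, Sum.elim_inl, Sum.elim_inr, id, Pi.one_apply, Pi.neg_apply, one_mul,
      neg_smul, one_smul, neg_neg] at h h'
    rw [← one_smul ℂ (symmVec (nomuraVec A i j))] at h h'
    rw [nomuraVec_matW_inl_inl]
    exact exists_restrict_inl_mulVec_eq one_ne_zero h h'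
  · have h := hc (.inl (.inl i)) (.inr (.inl j))
    have h' := hc (.inl (.inl i)) (.inr (.inr j))
    rw [nomuraVec_matV_inl_inr] at h h'
    simp only [colSign, base, Sum.elim_inl, Sum.elim_inr, id, Pi.one_apply, Pi.neg_apply, one_mul,
      neg_mul, neg_smul] at h h'
    rw [nomuraVec_matW_inl_inr]
    exact exists_restrict_inl_mulVec_eq hd h h'
  · have h := hc (.inr (.inl i)) (.inl (.inl j))
    have h' := hc (.inr (.inr i)) (.inl (.inl j))
    rw [nomuraVec_matV_inr_inl] at h h'
    simp only [colSign, base, Sum.elim_inl, Sum.elim_inr, id, Pi.one_apply, Pi.neg_apply, one_mul,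
      neg_mul, neg_smul] at h h'
    rw [nomuraVec_matW_inr_inl]
    exact exists_restrict_inl_mulVec_eq (inv_ne_zero hd) h h'
  · have h := hc (.inr (.inl i)) (.inr (.inl j))
    have h' := hc (.inr (.inl i)) (.inr (.inr j))
    rw [nomuraVec_matV_inr_inr hd] at h h'
    simp only [colSign, base, Sum.elim_inl, Sum.elim_inr, id, Pi.one_apply, Pi.neg_apply, one_mul,
      neg_smul, one_smul] at h h'
    rw [← one_smul ℂ (symmVec (nomuraVec B j i))] at h h'
    rw [nomuraVec_matW_inr_inr]
    exact exists_restrict_inl_mulVec_eq one_ne_zero h h'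

lemma submatrix_mem_nomura {κ : Type*} [Fintype κ] [DecidableEq κ] {M V : Matrix ι ι ℂ} (e : κ ≃ ι)
    (h : M ∈ nomura V) : M.submatrix e e ∈ nomura (V.submatrix e e) := fun i j => by
  obtain ⟨c, hc⟩ := h (e i) (e j)
  have hvec : nomuraVec (V.submatrix e e) i j = nomuraVec V (e i) (e j) ∘ e := rfl
  refine ⟨c, ?_⟩
  rw [hvec, submatrix_mulVec_equiv, Function.comp_assoc, Equiv.self_comp_symm, Function.comp_id, hc]
  rfl

omit [Fintype ι] [DecidableEq ι] in
lemma matV_submatrix_sumComm (d : ℂ) (A B : Matrix ι ι ℂ) :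
    (matV d A B).submatrix (Equiv.sumComm _ _) (Equiv.sumComm _ _) = matV d A Bᵀ :=
  fromBlocks_submatrix_sum_swap_sum_swap _ _ _ _

lemma restrict_inr_image_eq_restrict_inl_image (d : ℂ) (A B : Matrix ι ι ℂ) :
    restrict Function.Embedding.inr ''
        (nomura (matV d A B) : Set (Matrix ((ι ⊕ ι) ⊕ (ι ⊕ ι)) ((ι ⊕ ι) ⊕ (ι ⊕ ι)) ℂ)) =
      restrict Function.Embedding.inl ''
        (nomura (matV d A Bᵀ) : Set (Matrix ((ι ⊕ ι) ⊕ (ι ⊕ ι)) ((ι ⊕ ι) ⊕ (ι ⊕ ι)) ℂ)) := by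
  have hswap (C : Matrix ι ι ℂ) {M} (hM : M ∈ nomura (matV d A C)) :
      M.submatrix (Equiv.sumComm _ _) (Equiv.sumComm _ _) ∈ nomura (matV d A Cᵀ) :=
    matV_submatrix_sumComm d A C ▸ submatrix_mem_nomura _ hM
  refine Set.Subset.antisymm ?_ ?_
  · rintro _ ⟨M, hM, rfl⟩
    exact ⟨_, hswap B hM, rfl⟩
  · rintro _ ⟨M, hM, rfl⟩
    exact ⟨_, transpose_transpose B ▸ hswap Bᵀ hM, rfl⟩

namespace IsInvertibleJonesPair

variable [Nonempty ι] {P : Matrix (ι ⊕ ι) (ι ⊕ ι) ℂ}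

lemma exists_eq_twist_of_mem_nomura_matW (h : IsInvertibleJonesPair A B)
    (hP : P ∈ nomura (matW A B)ᵀ) :
    ∃ F G, (∃ K, HasEigenMatrix A (schurInv A) F K) ∧ (∃ S, HasEigenMatrix A B G S) ∧
      P = twist F G := by
  choose c hc using (hP : ∀ i j, ∃ c : ℂ, P *ᵥ nomuraVec (matW A B)ᵀ i j =
    c • nomuraVec (matW A B)ᵀ i j)
  obtain ⟨F, G, hF, hG, hPFG⟩ := exists_eq_twist (K := of fun i j => c (.inl i) (.inl j))
    (S := of fun i j => c (.inl i) (.inr j)) h.isTypeII_left.isUnit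
    h.isTypeII_right.isSchurInvertible h.isSchurInvertible.schurInv
    (fun i j => nomuraVec_matW_inl_inl A B i j ▸ hc (.inl i) (.inl j))
    (fun i j => nomuraVec_matW_inl_inr A B i j ▸ hc (.inl i) (.inr j))
  exact ⟨F, G, ⟨_, hF⟩, ⟨_, hG⟩, hPFG⟩

lemma nomura_matW_transpose_le (h : IsInvertibleJonesPair A B) (hA : A.IsSymm) :
    nomura (matW A B)ᵀ ≤ nomura (matW A Bᵀ)ᵀ := fun P hP => by
  obtain ⟨F, G, ⟨K, hF⟩, ⟨S, hG⟩, rfl⟩ := h.exists_eq_twist_of_mem_nomura_matW hP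
  obtain ⟨T, hG'⟩ := h.exists_hasEigenMatrix_transpose_right hG
  obtain ⟨-, K', hFB, -, -⟩ := h.transpose.exists_extension_symm hA hF
  obtain ⟨-, S', hGinv, -, -⟩ := h.transpose.exists_extension_skew hA hG'
  exact twist_mem_nomura_matW hF hFB hG' hGinv

lemma nomura_matW_transpose_eq (h : IsInvertibleJonesPair A B) (hA : A.IsSymm) :
    nomura (matW A Bᵀ)ᵀ = nomura (matW A B)ᵀ :=
  le_antisymm (transpose_transpose B ▸ h.transpose.nomura_matW_transpose_le hA)
    (h.nomura_matW_transpose_le hA)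

lemma restrict_inl_image_nomura_matV (h : IsInvertibleJonesPair A B) (hA : A.IsSymm) (hd : d ≠ 0) :
    restrict Function.Embedding.inl ''
        (nomura (matV d A B) : Set (Matrix ((ι ⊕ ι) ⊕ (ι ⊕ ι)) ((ι ⊕ ι) ⊕ (ι ⊕ ι)) ℂ)) =
      (nomura (matW A B)ᵀ : Set (Matrix (ι ⊕ ι) (ι ⊕ ι) ℂ)) := by
  refine Set.Subset.antisymm ?_ fun P hP => ?_
  · rintro _ ⟨M, hM, rfl⟩
    exact restrict_inl_mem_nomura_matW hd hM
  · obtain ⟨F, G, ⟨K, hF⟩, ⟨S, hG⟩, rfl⟩ := h.exists_eq_twist_of_mem_nomura_matW hP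
    obtain ⟨F', K', hFB, hF'B, hF'A⟩ := h.exists_extension_symm hA hF
    obtain ⟨G', S', hGinv, hG'inv, hG'⟩ := h.exists_extension_skew hA hG
    exact ⟨fromBlocks (twist F G) 0 0 (twist F' G'),
      fromBlocks_twist_mem_nomura_matV hd hF hFB hF'B hF'A hG hGinv hG'inv hG', rfl⟩

lemma restrict_inr_image_nomura_matV (h : IsInvertibleJonesPair A B) (hA : A.IsSymm) (hd : d ≠ 0) :
    restrict Function.Embedding.inr ''
        (nomura (matV d A B) : Set (Matrix ((ι ⊕ ι) ⊕ (ι ⊕ ι)) ((ι ⊕ ι) ⊕ (ι ⊕ ι)) ℂ)) =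
      (nomura (matW A B)ᵀ : Set (Matrix (ι ⊕ ι) (ι ⊕ ι) ℂ)) := by
  rw [restrict_inr_image_eq_restrict_inl_image, h.transpose.restrict_inl_image_nomura_matV hA hd,
    h.nomura_matW_transpose_eq hA]

end IsInvertibleJonesPair

end NomuraVW

end JonesPair

open JonesPair in
theorem mainTheorem7_general {ι : Type*} [Fintype ι] [DecidableEq ι] [Nonempty ι]
    {A B : Matrix ι ι ℂ} (hA : A.IsSymm) (hAB : IsInvertibleJonesPair A B) {d : ℂ} (hd : d ≠ 0) :
    restrict Function.Embedding.inl ''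
        (nomura (matV d A B) : Set (Matrix ((ι ⊕ ι) ⊕ (ι ⊕ ι)) ((ι ⊕ ι) ⊕ (ι ⊕ ι)) ℂ)) =
      (nomura (matW A B).transpose : Set (Matrix (ι ⊕ ι) (ι ⊕ ι) ℂ)) ∧
    restrict Function.Embedding.inr ''
        (nomura (matV d A B) : Set (Matrix ((ι ⊕ ι) ⊕ (ι ⊕ ι)) ((ι ⊕ ι) ⊕ (ι ⊕ ι)) ℂ)) =
      (nomura (matW A B).transpose : Set (Matrix (ι ⊕ ι) (ι ⊕ ι) ℂ)) ∧
    ∃ (𝒱 : Finset (Matrix ((ι ⊕ ι) ⊕ (ι ⊕ ι)) ((ι ⊕ ι) ⊕ (ι ⊕ ι)) ℂ))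
      (𝒲 : Finset (Matrix (ι ⊕ ι) (ι ⊕ ι) ℂ)),
      IsSchemeOf 𝒱 (nomura (matV d A B)) ∧ IsSchemeOf 𝒲 (nomura (matW A B).transpose) ∧
      IsInducedScheme 𝒱 Function.Embedding.inl 𝒲 ∧
      IsInducedScheme 𝒱 Function.Embedding.inr 𝒲 := by
  have hV := (hAB.isTypeII_left.matV hd hAB.isTypeII_right).isSchemeOf_nomura
  have hW := (hAB.isTypeII_left.matW_transpose hAB.isTypeII_right).isSchemeOf_nomura
  have hl := hAB.restrict_inl_image_nomura_matV hA hd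
  have hr := hAB.restrict_inr_image_nomura_matV hA hd
  exact ⟨hl, hr, _, _, hV, hW,
    ⟨inferInstance, hV.1, hW.1, hl ▸ schurIdempotents_image_restrict _⟩,
    ⟨inferInstance, hV.1, hW.1, hr ▸ schurIdempotents_image_restrict _⟩⟩

theorem mainTheorem7 (n : ℕ) (hn : 0 < n) (A B : Matrix (Fin n) (Fin n) ℂ)
    (hA : A.IsSymm) (hAB : JonesPair.IsInvertibleJonesPair A B)
    (d : ℂ) (hd : d ^ 2 = (n : ℂ)) :
    JonesPair.restrict Function.Embedding.inl ''
        (JonesPair.nomura (JonesPair.matV d A B) :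
          Set (Matrix ((Fin n ⊕ Fin n) ⊕ (Fin n ⊕ Fin n))
            ((Fin n ⊕ Fin n) ⊕ (Fin n ⊕ Fin n)) ℂ)) =
      (JonesPair.nomura (JonesPair.matW A B).transpose :
        Set (Matrix (Fin n ⊕ Fin n) (Fin n ⊕ Fin n) ℂ)) ∧
    JonesPair.restrict Function.Embedding.inr ''
        (JonesPair.nomura (JonesPair.matV d A B) :
          Set (Matrix ((Fin n ⊕ Fin n) ⊕ (Fin n ⊕ Fin n))
            ((Fin n ⊕ Fin n) ⊕ (Fin n ⊕ Fin n)) ℂ)) =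
      (JonesPair.nomura (JonesPair.matW A B).transpose :
        Set (Matrix (Fin n ⊕ Fin n) (Fin n ⊕ Fin n) ℂ)) ∧
    ∃ (𝒱 : Finset (Matrix ((Fin n ⊕ Fin n) ⊕ (Fin n ⊕ Fin n))
          ((Fin n ⊕ Fin n) ⊕ (Fin n ⊕ Fin n)) ℂ))
      (𝒲 : Finset (Matrix (Fin n ⊕ Fin n) (Fin n ⊕ Fin n) ℂ)),
      JonesPair.IsSchemeOf 𝒱 (JonesPair.nomura (JonesPair.matV d A B)) ∧
      JonesPair.IsSchemeOf 𝒲 (JonesPair.nomura (JonesPair.matW A B).transpose) ∧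
      JonesPair.IsInducedScheme 𝒱 Function.Embedding.inl 𝒲 ∧
      JonesPair.IsInducedScheme 𝒱 Function.Embedding.inr 𝒲 := by
  have : Nonempty (Fin n) := Fin.pos_iff_nonempty.1 hn
  have hd0 : d ≠ 0 := ne_zero_pow two_ne_zero (hd ▸ Nat.cast_ne_zero.2 hn.ne')
  exact mainTheorem7_general hA hAB hd0
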